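/- Let $\delta,\kappa>0$ with $\kappa<\delta/2$. An $n\times n$ bipartite graph $\Gamma=([n],[n],E)$, with left vertices $j$ and right vertices $i$ (write $j\to i$ if $j$ and $i$ are connected), is called $(\delta,\kappa)$-broadly connected if (1) $\deg(i)\ge\delta n$ for every right vertex $i$; (2) $\deg(j)\ge\delta n$ for every left vertex $j$; (3) for every set $J$ of left vertices, the set $$I(J)=\{i\in[n] : j\to i \text{ for at least } \lfloor(\delta/2)|J|\rfloor \text{ of the } j\in J\}$$ satisfies $|I(J)|\ge\min((1+\kappa)|J|,n)$. The adjacency matrix of $\Gamma$ is the $n\times n$ matrix $A$ with $a_{j,i}=1$ if $j\to i$ and $a_{j,i}=0$ otherwise. Write $s_1(M)\ge\dots\ge s_n(M)\ge 0$ for the singular values of a real $n\times n$ matrix $M$, and $\odot$ for the entrywise product of matrices. Theorem. There are constants $c,c'>0$ and $n_0\in\mathbb{N}$, depending only on $\delta$ and $\kappa$, such that the following holds for every $n\ge n_0$. Let $\Gamma$ be a $(\delta,\kappa)$-broadly connected $n\times n$ bipartite graph with adjacency matrix $A$, and let $G$ be an $n\times n$ standard Gaussian matrix, i.e. with independent $N(0,1)$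 entries. Then for any $t>0$ $$\mathbb{P}\left(s_n(A\odot G)\le c\,t\,n^{-1/2}\right)\le t+e^{-c'n},$$ and for any integer $m$ with $n/2<m<n-4$ and any $t>0$ $$\mathbb{P}\left(s_m(A\odot G)\le c\,t\cdot\frac{n-m}{\sqrt n}\right)\le t^{(n-m)/4}+e^{-c'n}.$$ -/

import Mathlib

open MeasureTheory ProbabilityTheory
open scoped Matrix

noncomputable section

/-- An `m × n` bipartite graph `Γ = ([m], [n], E)`, given by its set `E` of edges; `(j, i) ∈ E` means
that the left vertex `j` is connected to the right vertex `i`, written `j → i`. -/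
structure BipGraph (m n : ℕ) where
  edges : Set (Fin m × Fin n)

namespace BipGraph

variable {m n : ℕ}

/-- `Γ.Adj j i` means `j → i`. -/
def Adj (Γ : BipGraph m n) (j : Fin m) (i : Fin n) : Prop := (j, i) ∈ Γ.edges

open Classical in
/-- The degree of a left vertex. -/
def degLeft (Γ : BipGraph m n) (j : Fin m) : ℕ :=
  (Finset.univ.filter fun i : Fin n => Γ.Adj j i).card

open Classical in
/-- The degree of a right vertex. -/
def degRight (Γ : BipGraph m n) (i : Fin n) : ℕ :=
  (Finset.univ.filter fun j : Fin m => Γ.Adj j i).card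

open Classical in
/-- The set `I(J)` of the broadly connected neighbours of a set `J` of left vertices: the right
vertices `i` such that `j → i` for at least `⌊(δ/2) |J|⌋` of the `j ∈ J`. -/
def broadNeighbors (Γ : BipGraph m n) (δ : ℝ) (J : Finset (Fin m)) : Finset (Fin n) :=
  Finset.univ.filter fun i : Fin n =>
    ⌊(δ / 2) * (J.card : ℝ)⌋ ≤ ((J.filter fun j => Γ.Adj j i).card : ℤ)

/-- `(δ, κ)`-broadly connected bipartite graphs (used for `δ, κ > 0` and `κ < δ / 2`). -/
structure BroadlyConnected (Γ : BipGraph m n) (δ κ : ℝ) : Prop where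
  degRight_ge : ∀ i : Fin n, δ * (m : ℝ) ≤ (Γ.degRight i : ℝ)
  degLeft_ge : ∀ j : Fin m, δ * (n : ℝ) ≤ (Γ.degLeft j : ℝ)
  card_broadNeighbors_ge : ∀ J : Finset (Fin m),
    min ((1 + κ) * (J.card : ℝ)) (n : ℝ) ≤ ((Γ.broadNeighbors δ J).card : ℝ)

open Classical in
/-- The adjacency matrix of a bipartite graph: rows are indexed by the left vertices, columns by the
right vertices, and the entry at `(j, i)` is `1` if `j → i` and `0` otherwise. -/
def adjMatrix (Γ : BipGraph m n) : Matrix (Fin m) (Fin n) ℝ :=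
  Matrix.of fun j i => if Γ.Adj j i then 1 else 0

end BipGraph

/-- `G` is a standard Gaussian random matrix under `P`: its entries are independent `N(0, 1)` random
variables. -/
structure IsStdGaussianMatrix {Ω : Type*} [MeasurableSpace Ω] {m n : ℕ}
    (G : Ω → Matrix (Fin m) (Fin n) ℝ) (P : Measure Ω) : Prop where
  hasLaw_entry : ∀ i j, HasLaw (fun ω => G ω i j) (gaussianReal 0 1) P
  indep_entries : iIndepFun (fun (p : Fin m × Fin n) (ω : Ω) => G ω p.1 p.2) P

/-- The `k`-th largest singular value `s_k(M)` of a real matrix, counted with multiplicity and from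
`k = 1` on, so that `s_n(M)` is the smallest one of an `n × n` matrix. (Mathlib's sequence of the
singular values of a linear map between Euclidean spaces starts at index `0`.) -/
def singVal {m n : ℕ} (M : Matrix (Fin m) (Fin n) ℝ) (k : ℕ) : ℝ :=
  (Matrix.toEuclideanLin M).singularValues (k - 1)

end

/-! Suppose `s_m(A ⊙ G)` is small. Then many dimensions of vectors have small image, even after
requiring them to vanish on a fixed set `I` of `r - 1` coordinates; choose `r` orthonormal ones.
None is nearly sparse, by a net argument, so for a positive proportion of indices `i` the projection
of the `i`-th basis vector to their span has squared norm of order at least `r / n`. Its image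
combines the `i`-th column with columns outside `R = I ∪ {i}`. Pairing it with unit normals to the
latter shows that the `i`-th column is nearly orthogonal to all these normals
(`card_nearly_orthogonal_columns_gt`).

The space of normals has dimension at least `r` and is independent of the `i`-th column. If every
unit normal puts mass on the neighbourhood of `i`, the column is a nondegenerate Gaussian on this
space, and near orthogonality costs `(const * t) ^ r` (`measure_column_nearly_orthogonal_le`).
Markov's inequality replaces a union bound over `i` (`exists_measure_singVal_le`).

Spread of the normals (`exists_measure_normal_not_spread_le`) is where broad connectedness enters. A
vector with `β n` large coordinates has about `(1 + κ) β n` image entries of variance bounded below.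
If it were close to a `β' n`-sparse vector with `β'` smaller than `(1 + κ) β` by a margin, the
small-ball estimate would beat the net of sparse vectors (`exists_scale_measure_small_image_le`).
Hence the number of large coordinates grows by a factor `1 + κ / 2` per step, at ever smaller
scales, until it reaches `(1 - δ / 2) n`; then it meets every neighbourhood, of size at least `δ n`,
in `δ n / 2` places. -/

/-! ### Linear combinations of independent Gaussians: independence and tails of sums of squares. -/

section GaussianCombinations

variable {Ω : Type*} [MeasurableSpace Ω] {P : Measure Ω} {ι κ : Type*} [Fintype ι]
  {g : ι → Ω → ℝ}

lemma integrable_exp_mul_sq_gaussianReal {s : ℝ} (hs : s < 1 / 2) :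
    Integrable (fun x : ℝ => Real.exp (s * x ^ 2)) (gaussianReal 0 1) := by
  rw [gaussianReal_of_var_ne_zero _ one_ne_zero, integrable_withDensity_iff
    (measurable_gaussianPDF _ _) (by simp [gaussianPDF])]
  simp only [toReal_gaussianPDF, gaussianPDFReal]
  have h := (integrable_exp_neg_mul_sq (b := 1 / 2 - s) (by linarith)).mul_const
    (√(2 * Real.pi * (1 : NNReal)))⁻¹
  refine h.congr (ae_of_all _ fun x => ?_)
  simp only
  rw [mul_left_comm, ← Real.exp_add, mul_comm]
  congr 2
  simp
  ring

lemma integral_exp_mul_sq_gaussianReal {s : ℝ} (hs : s < 1 / 2) :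
    ∫ x, Real.exp (s * x ^ 2) ∂(gaussianReal 0 1) = (√(1 - 2 * s))⁻¹ := by
  rw [integral_gaussianReal_eq_integral_smul one_ne_zero]
  have h : ∀ x : ℝ, gaussianPDFReal 0 1 x • Real.exp (s * x ^ 2)
      = (√(2 * Real.pi))⁻¹ * Real.exp (-(1 / 2 - s) * x ^ 2) := by
    intro x
    simp only [gaussianPDFReal, smul_eq_mul]
    rw [mul_assoc, ← Real.exp_add]
    simp
    ring_nf
    simp
  simp_rw [h]
  rw [integral_const_mul, integral_gaussian, ← Real.sqrt_inv, ← Real.sqrt_inv, ← Real.sqrt_mul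
    (by positivity)]
  congr 1
  have : 1 - 2 * s ≠ 0 := by linarith
  have : 1 / 2 - s ≠ 0 := by linarith
  field_simp

lemma gaussianReal_eq_map_sqrt (v : NNReal) :
    gaussianReal 0 v = (gaussianReal 0 1).map (fun x => √(v : ℝ) * x) := by
  rw [gaussianReal_map_const_mul]
  congr 1
  · simp
  · ext; simp

lemma integrable_exp_mul_sq {X : Ω → ℝ} {v : NNReal} (hX : HasLaw X (gaussianReal 0 v) P) {t : ℝ}
    (ht : t * v < 1 / 2) : Integrable (fun ω => Real.exp (t * X ω ^ 2)) P := by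
  have h1 : Integrable (fun x : ℝ => Real.exp (t * x ^ 2)) (gaussianReal 0 v) := by
    rw [gaussianReal_eq_map_sqrt, integrable_map_measure (by fun_prop) (by fun_prop)]
    refine (integrable_exp_mul_sq_gaussianReal ht).congr (ae_of_all _ fun x => ?_)
    simp [mul_pow, mul_assoc]
  rw [← hX.map_eq, integrable_map_measure (by fun_prop) hX.aemeasurable] at h1
  exact h1

lemma mgf_sq {X : Ω → ℝ} {v : NNReal} (hX : HasLaw X (gaussianReal 0 v) P) {t : ℝ}
    (ht : t * v < 1 / 2) : mgf (fun ω => X ω ^ 2) P t = (√(1 - 2 * (t * v)))⁻¹ := by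
  have h1 := hX.integral_comp (f := fun x : ℝ => Real.exp (t * x ^ 2)) (by fun_prop)
  rw [mgf]
  simp only [Function.comp_def] at h1
  rw [h1, gaussianReal_eq_map_sqrt, integral_map (by fun_prop) (by fun_prop),
    ← integral_exp_mul_sq_gaussianReal ht]
  simp [mul_pow, mul_assoc]

lemma hasGaussianLaw_family (hg : iIndepFun g P) (hl : ∀ p, HasLaw (g p) (gaussianReal 0 1) P) :
    HasGaussianLaw (fun ω p => g p ω) P :=
  iIndepFun.hasGaussianLaw (fun p => (hl p).hasGaussianLaw) hg

/-- The linear combinations of the `g p` with coefficient vectors `c k`. -/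
def linComb (g : ι → Ω → ℝ) (c : κ → ι → ℝ) (k : κ) (ω : Ω) : ℝ := ∑ p, c k p * g p ω

lemma covariance_linComb (hg : iIndepFun g P) (hl : ∀ p, HasLaw (g p) (gaussianReal 0 1) P)
    (c : κ → ι → ℝ) (k l : κ) :
    cov[linComb g c k, linComb g c l; P] = ∑ p, c k p * c l p := by
  classical
  have hP := hg.isProbabilityMeasure
  have hm : ∀ p, MemLp (g p) 2 P := fun p => (hl p).hasGaussianLaw.memLp_two
  unfold linComb
  rw [covariance_fun_sum_fun_sum (fun p => (hm p).const_mul _) (fun p => (hm p).const_mul _)]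
  refine Finset.sum_congr rfl fun p _ => ?_
  rw [Finset.sum_eq_single p]
  · rw [covariance_const_mul_left, covariance_const_mul_right,
      covariance_self (hl p).aemeasurable, (hl p).variance_eq, variance_id_gaussianReal]
    simp
  · intro q _ hq
    rw [covariance_const_mul_left, covariance_const_mul_right,
      (hg.indepFun hq.symm).covariance_eq_zero (hm p) (hm q)]
    simp
  · simp

lemma hasGaussianLaw_linComb [Finite κ] (hg : iIndepFun g P)
    (hl : ∀ p, HasLaw (g p) (gaussianReal 0 1) P) (c : κ → ι → ℝ) :
    HasGaussianLaw (fun ω k => linComb g c k ω) P := by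
  have := Fintype.ofFinite κ
  have h := (hasGaussianLaw_family hg hl).map_fun
    (LinearMap.toContinuousLinearMap (Matrix.mulVecLin (Matrix.of c)))
  refine h.congr (ae_of_all _ fun ω => ?_)
  ext k
  simp [linComb, Matrix.mulVec, dotProduct]

lemma hasLaw_linComb [Finite κ] (hg : iIndepFun g P)
    (hl : ∀ p, HasLaw (g p) (gaussianReal 0 1) P) (c : κ → ι → ℝ) (k : κ) :
    HasLaw (linComb g c k) (gaussianReal 0 (∑ p, c k p ^ 2).toNNReal) P := by
  have h := (hasGaussianLaw_linComb hg hl c).eval k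
  refine ⟨h.aemeasurable, ?_⟩
  have h2 := h.map_eq_gaussianReal
  have hi : ∀ p, Integrable (g p) P := fun p => (hl p).hasGaussianLaw.integrable
  have hz : ∀ p, ∫ ω, g p ω ∂P = 0 := fun p => by
    rw [(hl p).integral_eq, integral_id_gaussianReal]
  have h3 : ∫ ω, linComb g c k ω ∂P = 0 := by
    unfold linComb
    rw [integral_finsetSum _ fun p _ => (hi p).const_mul _]
    simp [integral_const_mul, hz]
  have h4 : Var[linComb g c k; P] = ∑ p, c k p ^ 2 := by
    rw [← covariance_self h.aemeasurable, covariance_linComb hg hl]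
    simp [sq]
  change P.map (linComb g c k) = gaussianReal (∫ ω, linComb g c k ω ∂P) _ at h2
  rw [h2, h3, ← h4]

/-- Jointly Gaussian variables that are uncorrelated are independent. -/
lemma iIndepFun_linComb [Finite κ] (hg : iIndepFun g P)
    (hl : ∀ p, HasLaw (g p) (gaussianReal 0 1) P) {c : κ → ι → ℝ}
    (hc : ∀ k l, k ≠ l → ∑ p, c k p * c l p = 0) : iIndepFun (linComb g c) P :=
  (hasGaussianLaw_linComb hg hl c).iIndepFun_of_covariance_eq_zero fun k l hkl => by
    rw [covariance_linComb hg hl, hc k l hkl]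

lemma iIndepFun_sq_linComb [Finite κ] (hg : iIndepFun g P)
    (hl : ∀ p, HasLaw (g p) (gaussianReal 0 1) P) {c : κ → ι → ℝ}
    (hc : ∀ k l, k ≠ l → ∑ p, c k p * c l p = 0) :
    iIndepFun (fun k ω => linComb g c k ω ^ 2) P :=
  (iIndepFun_linComb hg hl hc).comp (fun _ x => x ^ 2) fun _ => by fun_prop

/-- The variables are only a.e. measurable, so one passes to measurable modifications. -/
lemma integrable_exp_mul_sum₀ {X : κ → Ω → ℝ} {t : ℝ} (hX : iIndepFun X P)
    (hm : ∀ k, AEMeasurable (X k) P) (s : Finset κ)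
    (hi : ∀ k ∈ s, Integrable (fun ω => Real.exp (t * X k ω)) P) :
    Integrable (fun ω => Real.exp (t * (∑ k ∈ s, X k) ω)) P := by
  have := hX.isProbabilityMeasure
  have h1 : iIndepFun (fun k => (hm k).mk) P := hX.congr fun k => (hm k).ae_eq_mk
  have h2 := h1.integrable_exp_mul_sum (t := t) (fun k => (hm k).measurable_mk) (s := s)
    fun k hk => (hi k hk).congr ((hm k).ae_eq_mk.mono fun ω h => by simp only [h])
  refine h2.congr ?_
  have h3 : ∀ᵐ ω ∂P, ∀ k ∈ s, X k ω = (hm k).mk _ ω :=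
    (Finset.eventually_all s).2 fun k _ => (hm k).ae_eq_mk
  filter_upwards [h3] with ω h
  simp only [Finset.sum_apply]
  rw [Finset.sum_congr rfl h]

/-- Chernoff's bound at a negative parameter: each square contributes a factor `(1 + 2 |t| v) ^
(-1/2)`, where `v ≥ σ ^ 2` is its variance. -/
lemma measure_sum_sq_linComb_le [Finite κ] (hg : iIndepFun g P)
    (hl : ∀ p, HasLaw (g p) (gaussianReal 0 1) P) {c : κ → ι → ℝ}
    (hc : ∀ k l, k ≠ l → ∑ p, c k p * c l p = 0) (s : Finset κ) {σ S : ℝ} (hσ : 0 < σ)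
    (hv : ∀ k ∈ s, σ ^ 2 ≤ ∑ p, c k p ^ 2) (hS : 0 < S) :
    P.real {ω | ∑ k ∈ s, linComb g c k ω ^ 2 ≤ S ^ 2} ≤ (2 * S / (σ * √(s.card : ℝ))) ^ s.card := by
  have := hg.isProbabilityMeasure
  rcases s.eq_empty_or_nonempty with rfl | hne
  · simp
  -- With this `t` the exponential prefactor is `exp (r / 2)`, and `√e ≤ 2` yields the constant `2`.
  set r : ℝ := (s.card : ℝ) with hr
  have hr0 : 0 < r := by simpa [hr] using hne.card_pos
  set t : ℝ := -(r / (2 * S ^ 2)) with ht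
  have ht0 : t < 0 := by rw [ht]; apply neg_lt_zero.2; positivity
  have hlaw := hasLaw_linComb hg hl c
  have hcond : ∀ k, t * ((∑ p, c k p ^ 2).toNNReal : ℝ) < 1 / 2 := fun k => by
    have : t * ((∑ p, c k p ^ 2).toNNReal : ℝ) ≤ 0 := mul_nonpos_of_nonpos_of_nonneg ht0.le (by simp)
    linarith
  have hind := iIndepFun_sq_linComb hg hl hc
  have hm : ∀ k, AEMeasurable (fun ω => linComb g c k ω ^ 2) P :=
    fun k => (hlaw k).aemeasurable.pow_const 2
  have h1 := measure_le_le_exp_mul_mgf (μ := P) (X := ∑ k ∈ s, fun ω => linComb g c k ω ^ 2)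
    (S ^ 2) ht0.le
    (integrable_exp_mul_sum₀ hind hm s fun k _ => integrable_exp_mul_sq (hlaw k) (hcond k))
  rw [hind.mgf_sum₀ hm] at h1
  simp only [Finset.sum_apply] at h1
  refine h1.trans ?_
  have h2 : ∀ k ∈ s, mgf (fun ω => linComb g c k ω ^ 2) P t ≤ S / (σ * √r) := by
    intro k hk
    rw [mgf_sq (hlaw k) (hcond k), ← one_div, div_le_div_iff₀ (Real.sqrt_pos.2 (by
      linarith [hcond k])) (by positivity), one_mul, Real.coe_toNNReal _ (by positivity)]
    have : σ * √r = S * √((σ ^ 2 * r) / S ^ 2) := by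
      rw [Real.sqrt_div' _ (by positivity), Real.sqrt_sq hS.le, Real.sqrt_mul (by positivity),
        Real.sqrt_sq hσ.le]
      field_simp
    rw [this]
    gcongr
    have h3 := hv k hk
    have h4 : -(2 * (t * ∑ p, c k p ^ 2)) = (∑ p, c k p ^ 2) * r / S ^ 2 := by
      rw [ht]; field_simp
    have h5 : σ ^ 2 * r / S ^ 2 ≤ (∑ p, c k p ^ 2) * r / S ^ 2 := by gcongr
    linarith
  calc Real.exp (-t * S ^ 2) * ∏ k ∈ s, mgf (fun ω => linComb g c k ω ^ 2) P t
      ≤ 2 ^ s.card * ∏ k ∈ s, (S / (σ * √r)) := by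
        gcongr with k hk
        · exact Finset.prod_nonneg fun k _ => mgf_nonneg
        · have : -t * S ^ 2 = s.card * (1 / 2) := by rw [ht, ← hr]; field_simp
          rw [this, Real.exp_nat_mul]
          gcongr
          have := Real.exp_one_lt_d9
          have h : Real.exp (1 / 2) ^ 2 = Real.exp 1 := by rw [← Real.exp_nat_mul]; norm_num
          nlinarith [Real.exp_pos (1 / 2)]
        · exact fun k _ => mgf_nonneg
        · exact h2 k hk
    _ = _ := by rw [Finset.prod_const, ← mul_pow, mul_div_assoc]

lemma measure_le_sum_sq_linComb [Fintype κ] (hg : iIndepFun g P)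
    (hl : ∀ p, HasLaw (g p) (gaussianReal 0 1) P) {c : κ → ι → ℝ}
    (hc : ∀ k l, k ≠ l → ∑ p, c k p * c l p = 0)
    (hv : ∀ k, ∑ p, c k p ^ 2 ≤ 1) (S : ℝ) :
    P.real {ω | S ≤ ∑ k, linComb g c k ω ^ 2} ≤ Real.exp (-S / 4) * (√2) ^ Fintype.card κ := by
  have := hg.isProbabilityMeasure
  have hlaw := hasLaw_linComb hg hl c
  have hco : ∀ k, ((∑ p, c k p ^ 2).toNNReal : ℝ) = ∑ p, c k p ^ 2 := fun k =>
    Real.coe_toNNReal _ (by positivity)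
  have hcond : ∀ k, (1 / 4) * ((∑ p, c k p ^ 2).toNNReal : ℝ) < 1 / 2 := fun k => by
    rw [hco]; linarith [hv k]
  have hind := iIndepFun_sq_linComb hg hl hc
  have hm : ∀ k, AEMeasurable (fun ω => linComb g c k ω ^ 2) P :=
    fun k => (hlaw k).aemeasurable.pow_const 2
  have h1 := measure_ge_le_exp_mul_mgf (μ := P) (X := ∑ k, fun ω => linComb g c k ω ^ 2)
    S (t := 1 / 4) (by norm_num) (integrable_exp_mul_sum₀ hind hm Finset.univ fun k _ =>
      integrable_exp_mul_sq (hlaw k) (hcond k))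
  rw [hind.mgf_sum₀ hm] at h1
  simp only [Finset.sum_apply] at h1
  refine h1.trans ?_
  have h2 : ∀ k, mgf (fun ω => linComb g c k ω ^ 2) P (1 / 4) ≤ √2 := by
    intro k
    rw [mgf_sq (hlaw k) (hcond k), hco, ← Real.sqrt_inv]
    apply Real.sqrt_le_sqrt
    rw [inv_le_comm₀ (by linarith [hv k]) (by norm_num)]
    linarith [hv k]
  have h3 : -(1 / 4) * S = -S / 4 := by ring
  rw [h3]
  gcongr
  calc _ ≤ ∏ _k : κ, √2 := Finset.prod_le_prod (fun _ _ => mgf_nonneg) fun k _ => h2 k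
    _ = _ := by simp

end GaussianCombinations

/-! ### Nets of bounded sets and of sparse vectors. -/

section Nets

/-- Volume comparison: the disjoint balls of radius `ε / 2` lie in the ball of radius `3 / 2`. -/
lemma card_le_of_separated_unitBall {E : Type*} [NormedAddCommGroup E] [NormedSpace ℝ E]
    [FiniteDimensional ℝ E] {ε : ℝ} (hε : 0 < ε) (hε1 : ε ≤ 1) (s : Finset E)
    (hs : ∀ c ∈ s, ‖c‖ ≤ 1) (h : ∀ c ∈ s, ∀ d ∈ s, c ≠ d → ε ≤ ‖c - d‖) :
    (s.card : ℝ) ≤ (3 / ε) ^ Module.finrank ℝ E := by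
  borelize E
  let μ : Measure E := Measure.addHaar
  have D : Set.Pairwise (s : Set E) (Function.onFun Disjoint fun c => Metric.ball (c : E) (ε / 2)) := by
    rintro c hc d hd hcd
    apply Metric.ball_disjoint_ball
    rw [dist_eq_norm]
    linarith [h c hc d hd hcd]
  have A_subset : (⋃ c ∈ s, Metric.ball (c : E) (ε / 2)) ⊆ Metric.ball (0 : E) (3 / 2) := by
    refine Set.iUnion₂_subset fun x hx => Metric.ball_subset_ball' ?_
    rw [dist_zero_right]
    linarith [hs x hx]
  have I : (s.card : ENNReal) * ENNReal.ofReal ((ε / 2) ^ Module.finrank ℝ E) * μ (Metric.ball 0 1) ≤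
      ENNReal.ofReal ((3 / 2) ^ Module.finrank ℝ E) * μ (Metric.ball 0 1) :=
    calc _ = μ (⋃ c ∈ s, Metric.ball (c : E) (ε / 2)) := by
          rw [measure_biUnion_finset D fun c _ => measurableSet_ball]
          simp only [μ.addHaar_ball_of_pos _ (half_pos hε)]
          simp only [Finset.sum_const, nsmul_eq_mul, mul_assoc]
      _ ≤ μ (Metric.ball (0 : E) (3 / 2)) := measure_mono A_subset
      _ = _ := by simp only [μ.addHaar_ball_of_pos _ (show (0 : ℝ) < 3 / 2 by norm_num)]
  have J := (ENNReal.mul_le_mul_iff_left (Metric.measure_ball_pos μ (0 : E) zero_lt_one).ne'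
    measure_ball_lt_top.ne).1 I
  have K := ENNReal.toReal_le_of_le_ofReal (by positivity) J
  rw [ENNReal.toReal_mul, ENNReal.toReal_natCast, ENNReal.toReal_ofReal (by positivity)] at K
  have : (3 / ε) ^ Module.finrank ℝ E
      = (3 / 2) ^ Module.finrank ℝ E / (ε / 2) ^ Module.finrank ℝ E := by
    rw [← div_pow]; congr 1; field_simp
  rw [this, le_div_iff₀ (by positivity)]
  exact K

/-- The net lies in `A` itself, since the later probability estimates hold only for its members. -/
lemma exists_net_of_norm_le_one {E : Type*} [NormedAddCommGroup E] [NormedSpace ℝ E]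
    [FiniteDimensional ℝ E] {ε : ℝ} (hε : 0 < ε) (hε1 : ε ≤ 1) (A : Set E)
    (hA : ∀ x ∈ A, ‖x‖ ≤ 1) :
    ∃ N : Finset E, ↑N ⊆ A ∧ (N.card : ℝ) ≤ (3 / ε) ^ Module.finrank ℝ E ∧
      ∀ x ∈ A, ∃ z ∈ N, ‖x - z‖ ≤ ε := by
  classical
  by_contra! hcon
  -- Without a net every separated set could be enlarged, against the volume bound.
  have key : ∀ k : ℕ, ∃ N : Finset E, ↑N ⊆ A ∧ (∀ c ∈ N, ∀ d ∈ N, c ≠ d → ε ≤ ‖c - d‖) ∧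
      N.card = k := by
    intro k
    induction k with
    | zero => exact ⟨∅, by simp⟩
    | succ k ih =>
      obtain ⟨N, hN, hsep, hk⟩ := ih
      obtain ⟨x, hx, hfar⟩ := hcon N hN
        (card_le_of_separated_unitBall hε hε1 N (fun c hc => hA c (hN hc)) hsep)
      have hxN : x ∉ N := fun h => by have := hfar x h; simp at this; linarith
      refine ⟨insert x N, ?_, ?_, by rw [Finset.card_insert_of_notMem hxN, hk]⟩
      · simpa [Set.insert_subset_iff] using ⟨hx, hN⟩
      · intro c hc d hd hcd
        rcases Finset.mem_insert.1 hc with rfl | hcN <;>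
          rcases Finset.mem_insert.1 hd with rfl | hdN
        · exact absurd rfl hcd
        · exact (hfar d hdN).le
        · rw [norm_sub_rev]; exact (hfar c hcN).le
        · exact hsep c hcN d hdN hcd
  obtain ⟨m, hm⟩ := exists_nat_gt ((3 / ε) ^ Module.finrank ℝ E)
  obtain ⟨N, hN, hsep, hk⟩ := key m
  have := card_le_of_separated_unitBall hε hε1 N (fun c hc => hA c (hN hc)) hsep
  rw [hk] at this
  linarith

-- For each of the `2 ^ n` possible supports, take a net in the coordinate subspace, whose dimension
-- is at most `k`.
open Classical in
lemma exists_net_of_sparse {n k : ℕ} {ε : ℝ} (hε : 0 < ε) (hε1 : ε ≤ 1)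
    (Y : Set (EuclideanSpace ℝ (Fin n))) (hY : ∀ y ∈ Y, ‖y‖ ≤ 1)
    (hk : ∀ y ∈ Y, (Finset.univ.filter fun j => y j ≠ 0).card ≤ k) :
    ∃ N : Finset (EuclideanSpace ℝ (Fin n)), ↑N ⊆ Y ∧ (N.card : ℝ) ≤ 2 ^ n * (3 / ε) ^ k ∧
      ∀ x ∈ Y, ∃ z ∈ N, ‖x - z‖ ≤ ε := by
  have h3 : 1 ≤ 3 / ε := by rw [le_div_iff₀ hε]; linarith
  have key : ∀ T : Finset (Fin n), ∃ N : Finset (EuclideanSpace ℝ (Fin n)), ↑N ⊆ Y ∧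
      (N.card : ℝ) ≤ (3 / ε) ^ k ∧
      ∀ x ∈ Y, (Finset.univ.filter fun j => x j ≠ 0) = T → ∃ z ∈ N, ‖x - z‖ ≤ ε := by
    intro T
    by_cases hT : T.card ≤ k
    swap
    · refine ⟨∅, by simp, by simp; positivity, fun x hx hxT => ?_⟩
      exact absurd (hxT ▸ hk x hx) hT
    set W : Submodule ℝ (EuclideanSpace ℝ (Fin n)) := Submodule.span ℝ
      (↑(T.image fun j => EuclideanSpace.basisFun (Fin n) ℝ j) : Set _) with hW
    have hdim : Module.finrank ℝ W ≤ k :=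
      (finrank_span_finset_le_card _).trans (Finset.card_image_le.trans hT)
    obtain ⟨N, hN, hcard, hnet⟩ := exists_net_of_norm_le_one hε hε1 (E := W)
      {w | (w : EuclideanSpace ℝ (Fin n)) ∈ Y} fun w hw => hY _ hw
    refine ⟨N.image (↑), ?_, ?_, ?_⟩
    · intro z hz
      obtain ⟨w, hw, rfl⟩ := Finset.mem_image.1 (Finset.mem_coe.1 hz)
      exact hN hw
    · calc ((N.image _).card : ℝ) ≤ N.card := by exact_mod_cast Finset.card_image_le
        _ ≤ _ := hcard
        _ ≤ _ := pow_le_pow_right₀ h3 hdim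
    · intro x hx hxT
      have hxW : x ∈ W := by
        rw [← (EuclideanSpace.basisFun (Fin n) ℝ).sum_repr x]
        refine Submodule.sum_mem _ fun j _ => ?_
        by_cases hj : x j = 0
        · simp [hj]
        · refine Submodule.smul_mem _ _ (Submodule.subset_span ?_)
          exact Finset.mem_coe.2 (Finset.mem_image_of_mem _ (by simp [← hxT, hj]))
      obtain ⟨z, hz, hxz⟩ := hnet ⟨x, hxW⟩ hx
      exact ⟨z, Finset.mem_image_of_mem _ hz, hxz⟩
  choose N hNY hNcard hNnet using key
  refine ⟨Finset.univ.biUnion N, ?_, ?_, ?_⟩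
  · simpa using hNY
  · calc ((Finset.univ.biUnion N).card : ℝ) ≤ ∑ T : Finset (Fin n), ((N T).card : ℝ) := by
          exact_mod_cast Finset.card_biUnion_le
      _ ≤ ∑ _T : Finset (Fin n), (3 / ε) ^ k := Finset.sum_le_sum fun T _ => hNcard T
      _ = _ := by simp
  · intro x hx
    obtain ⟨z, hz, hxz⟩ := hNnet _ x hx rfl
    exact ⟨z, Finset.mem_biUnion.2 ⟨_, Finset.mem_univ _, hz⟩, hxz⟩

end Nets

/-! ### Gaussian matrices with a profile: small ball and operator norm. -/

section ProfileMatrix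

variable {n : ℕ} {Ω : Type*} [MeasurableSpace Ω] {P : Measure Ω}
  {G : Ω → Matrix (Fin n) (Fin n) ℝ}

lemma IsStdGaussianMatrix.transpose (h : IsStdGaussianMatrix G P) :
    IsStdGaussianMatrix (fun ω => (G ω)ᵀ) P :=
  ⟨fun i j => h.hasLaw_entry j i, h.indep_entries.precomp Prod.swap_injective⟩

lemma toEuclideanLin_hadamard_apply (b M : Matrix (Fin n) (Fin n) ℝ)
    (y : EuclideanSpace ℝ (Fin n)) (i : Fin n) :
    Matrix.toEuclideanLin (b ⊙ M) y i = ∑ j, b i j * y j * M i j := by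
  simp only [Matrix.toLpLin_apply, Matrix.mulVec, dotProduct, Matrix.hadamard_apply]
  exact Finset.sum_congr rfl fun j _ => by ring

/-- The variance of the `i`-th entry of `(b ⊙ G) y` for a standard Gaussian matrix `G`. -/
def rowVar (b : Matrix (Fin n) (Fin n) ℝ) (y : EuclideanSpace ℝ (Fin n)) (i : Fin n) : ℝ :=
  ∑ j, (b i j * y j) ^ 2

/-- The coefficients of the entries of `(b ⊙ G) y` as linear combinations of the entries of `G`. -/
def rowCoeff (b : Matrix (Fin n) (Fin n) ℝ) (y : EuclideanSpace ℝ (Fin n)) (i : Fin n)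
    (p : Fin n × Fin n) : ℝ := if p.1 = i then b i p.2 * y p.2 else 0

lemma linComb_rowCoeff (b : Matrix (Fin n) (Fin n) ℝ) (y : EuclideanSpace ℝ (Fin n)) (i : Fin n)
    {Ω' : Type*} (M : Ω' → Matrix (Fin n) (Fin n) ℝ) (ω : Ω') :
    linComb (fun (p : Fin n × Fin n) ω => M ω p.1 p.2) (rowCoeff b y) i ω
      = Matrix.toEuclideanLin (b ⊙ M ω) y i := by
  rw [toEuclideanLin_hadamard_apply, linComb, Fintype.sum_prod_type]
  simp [rowCoeff, ite_mul]

lemma sum_sq_rowCoeff (b : Matrix (Fin n) (Fin n) ℝ) (y : EuclideanSpace ℝ (Fin n)) (i : Fin n) :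
    ∑ p, rowCoeff b y i p ^ 2 = rowVar b y i := by
  rw [Fintype.sum_prod_type, rowVar]
  simp [rowCoeff, ite_pow]

lemma rowCoeff_orthogonal (b : Matrix (Fin n) (Fin n) ℝ) (y : EuclideanSpace ℝ (Fin n))
    (i k : Fin n) (hik : i ≠ k) : ∑ p, rowCoeff b y i p * rowCoeff b y k p = 0 := by
  refine Finset.sum_eq_zero fun p _ => ?_
  unfold rowCoeff
  by_cases h : p.1 = i
  · rw [if_neg (c := p.1 = k) (by rw [h]; exact hik), mul_zero]
  · rw [if_neg h, zero_mul]

lemma rowVar_le_norm_sq {b : Matrix (Fin n) (Fin n) ℝ} (hb : ∀ i j, |b i j| ≤ 1)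
    (y : EuclideanSpace ℝ (Fin n)) (i : Fin n) : rowVar b y i ≤ ‖y‖ ^ 2 := by
  rw [EuclideanSpace.real_norm_sq_eq, rowVar]
  refine Finset.sum_le_sum fun j _ => ?_
  rw [mul_pow]
  exact mul_le_of_le_one_left (sq_nonneg _) ((sq_le_one_iff_abs_le_one _).2 (hb i j))

/-- Distinct entries of the image use disjoint rows of `G`, hence are independent; only those in `s`
are kept. -/
lemma measure_norm_hadamard_le (h : IsStdGaussianMatrix G P) (b : Matrix (Fin n) (Fin n) ℝ)
    (y : EuclideanSpace ℝ (Fin n)) (s : Finset (Fin n)) {σ S : ℝ} (hσ : 0 < σ)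
    (hv : ∀ i ∈ s, σ ^ 2 ≤ rowVar b y i) (hS : 0 < S) :
    P.real {ω | ‖Matrix.toEuclideanLin (b ⊙ G ω) y‖ ≤ S}
      ≤ (2 * S / (σ * √(s.card : ℝ))) ^ s.card := by
  have := h.indep_entries.isProbabilityMeasure
  have key := measure_sum_sq_linComb_le h.indep_entries (fun p => h.hasLaw_entry p.1 p.2)
    (rowCoeff_orthogonal b y) s hσ (fun i hi => by rw [sum_sq_rowCoeff]; exact hv i hi) hS
  refine le_trans (measureReal_mono ?_) key
  intro ω hω
  simp only [Set.mem_ofPred_eq] at hω ⊢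
  simp_rw [linComb_rowCoeff]
  calc _ ≤ ∑ i, Matrix.toEuclideanLin (b ⊙ G ω) y i ^ 2 :=
        Finset.sum_le_sum_of_subset_of_nonneg (Finset.subset_univ _) fun _ _ _ => sq_nonneg _
    _ = ‖Matrix.toEuclideanLin (b ⊙ G ω) y‖ ^ 2 := (EuclideanSpace.real_norm_sq_eq _).symm
    _ ≤ S ^ 2 := by gcongr

lemma measure_le_norm_hadamard (h : IsStdGaussianMatrix G P) {b : Matrix (Fin n) (Fin n) ℝ}
    (hb : ∀ i j, |b i j| ≤ 1) {y : EuclideanSpace ℝ (Fin n)} (hy : ‖y‖ ≤ 1) {S : ℝ} (hS : 0 ≤ S) :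
    P.real {ω | S ≤ ‖Matrix.toEuclideanLin (b ⊙ G ω) y‖} ≤ Real.exp (-S ^ 2 / 4) * √2 ^ n := by
  have := h.indep_entries.isProbabilityMeasure
  have key := measure_le_sum_sq_linComb h.indep_entries (fun p => h.hasLaw_entry p.1 p.2)
    (rowCoeff_orthogonal b y) (fun i => by
      rw [sum_sq_rowCoeff]
      exact (rowVar_le_norm_sq hb y i).trans (pow_le_one₀ (norm_nonneg _) hy)) (S ^ 2)
  rw [Fintype.card_fin] at key
  refine le_trans (measureReal_mono ?_) key
  intro ω hω
  simp only [Set.mem_ofPred_eq] at hω ⊢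
  simp_rw [linComb_rowCoeff, ← EuclideanSpace.real_norm_sq_eq]
  gcongr

/-- The event that `b ⊙ G` has operator norm at most `8 √n`. -/
def normBounded (b : Matrix (Fin n) (Fin n) ℝ) (G : Ω → Matrix (Fin n) (Fin n) ℝ) : Set Ω :=
  {ω | ∀ x, ‖Matrix.toEuclideanLin (b ⊙ G ω) x‖ ≤ 8 * √(n : ℝ) * ‖x‖}

/-- A `1/2`-net has at most `6 ^ n` points and controls the norm up to a factor `2`; a point exceeds
`4 √n` with probability at most `(exp (-4) * √2) ^ n`. -/
lemma measure_compl_normBounded_le (h : IsStdGaussianMatrix G P) {b : Matrix (Fin n) (Fin n) ℝ}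
    (hb : ∀ i j, |b i j| ≤ 1) : P.real (normBounded b G)ᶜ ≤ Real.exp (-n) := by
  have := h.indep_entries.isProbabilityMeasure
  obtain ⟨N, hN, hcard, hnet⟩ := exists_net_of_norm_le_one (E := EuclideanSpace ℝ (Fin n))
    (ε := 1 / 2) (by norm_num) (by norm_num) {x | ‖x‖ ≤ 1} fun x hx => hx
  rw [finrank_euclideanSpace_fin] at hcard
  have hsub : (normBounded b G)ᶜ ⊆
      ⋃ z ∈ N, {ω | 4 * √(n : ℝ) ≤ ‖Matrix.toEuclideanLin (b ⊙ G ω) z‖} := by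
    intro ω hω
    by_contra hcon
    simp only [Set.mem_iUnion, Set.mem_ofPred_eq, not_exists, not_le] at hcon
    apply hω
    set T := LinearMap.toContinuousLinearMap (Matrix.toEuclideanLin (b ⊙ G ω)) with hT
    have h1 : ‖T‖ ≤ 4 * √(n : ℝ) + ‖T‖ * (1 / 2) := by
      refine ContinuousLinearMap.opNorm_le_of_unit_norm (by positivity) fun x hx => ?_
      obtain ⟨z, hz, hxz⟩ := hnet x hx.le
      calc ‖T x‖ = ‖T z + T (x - z)‖ := by rw [← map_add]; simp
        _ ≤ ‖T z‖ + ‖T (x - z)‖ := norm_add_le _ _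
        _ ≤ _ := add_le_add (hcon z hz).le ((T.le_opNorm _).trans (by gcongr))
    intro x
    exact (T.le_opNorm x).trans (by gcongr; linarith)
  have hexp : (6 * Real.exp (-4) * √2) ≤ Real.exp (-1) := by
    have h2 : √2 ≤ 3 / 2 := by rw [Real.sqrt_le_left (by norm_num)]; norm_num
    have h3 : Real.exp (-1) = Real.exp (-4) * Real.exp 1 ^ 3 := by
      rw [← Real.exp_nat_mul, ← Real.exp_add]; norm_num
    have h4 : (9 : ℝ) ≤ Real.exp 1 ^ 3 := by
      have := Real.exp_one_gt_d9
      calc (9 : ℝ) ≤ 2.7 ^ 3 := by norm_num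
        _ ≤ _ := by gcongr; linarith
    rw [h3]
    nlinarith [Real.exp_pos (-4), Real.sqrt_nonneg 2]
  calc P.real (normBounded b G)ᶜ ≤ _ := measureReal_mono hsub (measure_ne_top _ _)
    _ ≤ ∑ z ∈ N, P.real {ω | 4 * √(n : ℝ) ≤ ‖Matrix.toEuclideanLin (b ⊙ G ω) z‖} :=
        measureReal_biUnion_finset_le _ _
    _ ≤ ∑ z ∈ N, Real.exp (-(4 * √(n : ℝ)) ^ 2 / 4) * √2 ^ n :=
        Finset.sum_le_sum fun z hz => measure_le_norm_hadamard h hb (hN hz) (by positivity)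
    _ = N.card * (Real.exp (-4) ^ n * √2 ^ n) := by
        rw [Finset.sum_const, nsmul_eq_mul, ← Real.exp_nat_mul, mul_pow,
          Real.sq_sqrt (Nat.cast_nonneg _)]
        ring_nf
    _ ≤ 6 ^ n * (Real.exp (-4) ^ n * √2 ^ n) := by
        gcongr
        norm_num at hcard
        exact hcard
    _ = (6 * Real.exp (-4) * √2) ^ n := by rw [mul_pow, mul_pow]; ring
    _ ≤ Real.exp (-1) ^ n := by gcongr
    _ = Real.exp (-n) := by rw [← Real.exp_nat_mul]; ring_nf

end ProfileMatrix

/-! ### Net argument: sparsity against the number of nondegenerate entries. -/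

open Classical in
/-- A small image is unlikely on a family of sparse vectors for which `(b ⊙ G) y` has more
nondegenerate entries than `y` has degrees of freedom. -/
theorem exists_scale_measure_small_image_le {σ η a : ℝ} (hσ : 0 < σ) (hη : 0 < η) (ha : 0 < a) :
    ∃ ε : ℝ, 0 < ε ∧ ε ≤ a ∧ ε ≤ 1 ∧ ∀ {n : ℕ}, 0 < n → ∀ {Ω : Type*} [MeasurableSpace Ω]
      {P : Measure Ω} {G : Ω → Matrix (Fin n) (Fin n) ℝ}, IsStdGaussianMatrix G P →
      ∀ (b : Matrix (Fin n) (Fin n) ℝ) (k : ℕ) (Y : Set (EuclideanSpace ℝ (Fin n))),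
      (∀ y ∈ Y, ‖y‖ ≤ 1) → (∀ y ∈ Y, (Finset.univ.filter fun j => y j ≠ 0).card ≤ k) →
      (∀ y ∈ Y, (k : ℝ) + η * n ≤ (Finset.univ.filter fun i => σ ^ 2 ≤ rowVar b y i).card) →
      P.real (normBounded b G ∩
        {ω | ∃ y ∈ Y, ‖Matrix.toEuclideanLin (b ⊙ G ω) y‖ ≤ 16 * ε * √(n : ℝ)})
        ≤ Real.exp (-n) := by
  -- The net has at most `6 ^ n * ε ^ (-k)` points, each failing with probability at most `D ^ n * ε
  -- ^ (k + η n)`. The powers `ε ^ k` cancel, and `ε₀` is chosen so that `ε₀ ^ (η n) = (6 e D) ^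
  -- (-n)`.
  set D : ℝ := max 1 (48 / (σ * √η)) with hD
  have hD1 : 1 ≤ D := le_max_left _ _
  set ε₀ : ℝ := (Real.exp 1 * (6 * D)) ^ (-(1 / η)) with hε₀
  have hbase : 0 < Real.exp 1 * (6 * D) := by positivity
  have hε₀0 : 0 < ε₀ := Real.rpow_pos_of_pos hbase _
  refine ⟨min ε₀ (min a 1), by positivity, (min_le_right _ _).trans (min_le_left _ _),
    (min_le_right _ _).trans (min_le_right _ _), ?_⟩
  intro n hn Ω _ P G h b k Y hY hk hr
  have := h.indep_entries.isProbabilityMeasure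
  set ε : ℝ := min ε₀ (min a 1) with hεdef
  have hε : 0 < ε := by positivity
  have hε1 : ε ≤ 1 := (min_le_right _ _).trans (min_le_right _ _)
  have hn0 : (0 : ℝ) < n := by exact_mod_cast hn
  obtain ⟨N, hN, hcard, hnet⟩ := exists_net_of_sparse hε hε1 Y hY hk
  have hsub : normBounded b G ∩
        {ω | ∃ y ∈ Y, ‖Matrix.toEuclideanLin (b ⊙ G ω) y‖ ≤ 16 * ε * √(n : ℝ)} ⊆
      ⋃ z ∈ N, {ω | ‖Matrix.toEuclideanLin (b ⊙ G ω) z‖ ≤ 24 * ε * √(n : ℝ)} := by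
    rintro ω ⟨hω, y, hy, hyω⟩
    obtain ⟨z, hz, hyz⟩ := hnet y hy
    refine Set.mem_biUnion hz ?_
    have h1 := hω (y - z)
    simp only [Set.mem_ofPred_eq]
    calc ‖Matrix.toEuclideanLin (b ⊙ G ω) z‖
        = ‖Matrix.toEuclideanLin (b ⊙ G ω) y - Matrix.toEuclideanLin (b ⊙ G ω) (y - z)‖ := by
          rw [← map_sub]; simp
      _ ≤ 16 * ε * √(n : ℝ) + 8 * √(n : ℝ) * ‖y - z‖ := (norm_sub_le _ _).trans (add_le_add hyω h1)
      _ ≤ 16 * ε * √(n : ℝ) + 8 * √(n : ℝ) * ε := by gcongr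
      _ = _ := by ring
  have hpoint : ∀ z ∈ N, P.real {ω | ‖Matrix.toEuclideanLin (b ⊙ G ω) z‖ ≤ 24 * ε * √(n : ℝ)}
      ≤ D ^ n * ε ^ k * (Real.exp 1 * (6 * D))⁻¹ ^ n := by
    intro z hz
    set s := Finset.univ.filter fun i => σ ^ 2 ≤ rowVar b z i with hs
    have hrz : (k : ℝ) + η * n ≤ s.card := hr z (hN hz)
    have hηs : η * n ≤ s.card := le_trans (by simp) hrz
    have hs0 : (0 : ℝ) < s.card := lt_of_lt_of_le (by positivity) hηs
    have hks : k ≤ s.card := by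
      have : (k : ℝ) ≤ s.card := le_trans (by simp; positivity) hrz
      exact_mod_cast this
    have hsn : s.card ≤ n := by simpa using Finset.card_le_univ s
    refine (measure_norm_hadamard_le h b z s hσ (fun i hi => (Finset.mem_filter.1 hi).2)
      (by positivity)).trans ?_
    have h1 : 2 * (24 * ε * √(n : ℝ)) / (σ * √(s.card : ℝ)) ≤ D * ε := by
      have h2 : √η * √(n : ℝ) ≤ √(s.card : ℝ) := by
        rw [← Real.sqrt_mul hη.le]; exact Real.sqrt_le_sqrt hηs
      calc 2 * (24 * ε * √(n : ℝ)) / (σ * √(s.card : ℝ))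
          ≤ 2 * (24 * ε * √(n : ℝ)) / (σ * (√η * √(n : ℝ))) := by gcongr
        _ = 48 / (σ * √η) * ε := by field_simp; norm_num
        _ ≤ D * ε := by gcongr; exact le_max_right _ _
    calc (2 * (24 * ε * √(n : ℝ)) / (σ * √(s.card : ℝ))) ^ s.card
        ≤ (D * ε) ^ s.card := by gcongr
      _ = D ^ s.card * (ε ^ k * ε ^ (s.card - k)) := by
          rw [mul_pow, ← pow_add, Nat.add_sub_cancel' hks]
      _ ≤ D ^ n * (ε ^ k * (Real.exp 1 * (6 * D))⁻¹ ^ n) := by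
          gcongr
          have h5 : η * n ≤ ((s.card - k : ℕ) : ℝ) := by
            rw [Nat.cast_sub hks]; linarith
          calc ε ^ (s.card - k) = ε ^ (((s.card - k : ℕ) : ℝ)) := (Real.rpow_natCast _ _).symm
            _ ≤ ε ^ (η * n) := Real.rpow_le_rpow_of_exponent_ge hε hε1 h5
            _ ≤ ε₀ ^ (η * n) := Real.rpow_le_rpow hε.le (min_le_left _ _) (by positivity)
            _ = (Real.exp 1 * (6 * D))⁻¹ ^ n := by
                rw [hε₀, ← Real.rpow_mul hbase.le, inv_pow, ← Real.rpow_natCast, ← Real.rpow_neg hbase.le]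
                congr 1; field_simp
      _ = _ := by ring
  -- Needed for `3 ^ k ≤ 3 ^ n`: a single net point has at least `k` nondegenerate entries; with no
  -- net point the event is empty.
  have hkn : k ≤ n ∨ N = ∅ := by
    rcases N.eq_empty_or_nonempty with h0 | ⟨z, hz⟩
    · exact Or.inr h0
    left
    have h1 := hr z (hN hz)
    have h2 : ((Finset.univ.filter fun i => σ ^ 2 ≤ rowVar b z i).card : ℝ) ≤ n := by
      exact_mod_cast (Finset.card_le_univ _).trans (by simp)
    have : (k : ℝ) ≤ n := by linarith [show 0 ≤ η * (n : ℝ) by positivity]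
    exact_mod_cast this
  rcases hkn with hkn | h0
  swap
  · rw [h0] at hsub
    have : P.real (normBounded b G ∩
        {ω | ∃ y ∈ Y, ‖Matrix.toEuclideanLin (b ⊙ G ω) y‖ ≤ 16 * ε * √(n : ℝ)}) = 0 := by
      rw [Set.subset_eq_empty hsub (by simp)]; simp
    rw [this]; positivity
  calc _ ≤ _ := measureReal_mono hsub (measure_ne_top _ _)
    _ ≤ ∑ z ∈ N, P.real {ω | ‖Matrix.toEuclideanLin (b ⊙ G ω) z‖ ≤ 24 * ε * √(n : ℝ)} :=
        measureReal_biUnion_finset_le _ _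
    _ ≤ ∑ z ∈ N, D ^ n * ε ^ k * (Real.exp 1 * (6 * D))⁻¹ ^ n := Finset.sum_le_sum hpoint
    _ = N.card * (D ^ n * ε ^ k * (Real.exp 1 * (6 * D))⁻¹ ^ n) := by simp
    _ ≤ (2 ^ n * (3 / ε) ^ k) * (D ^ n * ε ^ k * (Real.exp 1 * (6 * D))⁻¹ ^ n) := by gcongr
    _ = 2 ^ n * 3 ^ k * (D ^ n * (Real.exp 1 * (6 * D))⁻¹ ^ n) := by
        rw [div_pow]; field_simp
    _ ≤ 2 ^ n * 3 ^ n * (D ^ n * (Real.exp 1 * (6 * D))⁻¹ ^ n) := by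
        gcongr
        norm_num
    _ = (2 * 3 * (D * (Real.exp 1 * (6 * D))⁻¹)) ^ n := by rw [mul_pow, mul_pow, mul_pow]
    _ = (Real.exp (-1)) ^ n := by
        congr 1
        rw [Real.exp_neg]; field_simp; norm_num
    _ = Real.exp (-n) := by rw [← Real.exp_nat_mul]; ring_nf

/-! ### Truncation and large coordinates. -/

section Truncation

variable {n : ℕ}

open Classical in
/-- The vector `x` with the coordinates outside `T` replaced by `0`. -/
noncomputable def truncate (T : Finset (Fin n)) (x : EuclideanSpace ℝ (Fin n)) : EuclideanSpace ℝ (Fin n) :=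
  WithLp.toLp 2 fun j => if j ∈ T then x j else 0

open Classical in
lemma truncate_apply (T : Finset (Fin n)) (x : EuclideanSpace ℝ (Fin n)) (j : Fin n) :
    truncate T x j = if j ∈ T then x j else 0 := rfl

open Classical in
lemma norm_sub_truncate_sq (T : Finset (Fin n)) (x : EuclideanSpace ℝ (Fin n)) :
    ‖x - truncate T x‖ ^ 2 = ∑ j ∈ Tᶜ, x j ^ 2 := by
  rw [EuclideanSpace.real_norm_sq_eq, ← Finset.sum_add_sum_compl T, Finset.sum_eq_zero, zero_add]
  · refine Finset.sum_congr rfl fun j hj => ?_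
    simp [truncate_apply, Finset.mem_compl.1 hj]
  · intro j hj
    simp [truncate_apply, hj]

lemma norm_truncate_le (T : Finset (Fin n)) (x : EuclideanSpace ℝ (Fin n)) :
    ‖truncate T x‖ ≤ ‖x‖ := by
  refine le_of_sq_le_sq ?_ (norm_nonneg _)
  rw [EuclideanSpace.real_norm_sq_eq, EuclideanSpace.real_norm_sq_eq]
  refine Finset.sum_le_sum fun j _ => ?_
  rw [truncate_apply]
  split_ifs
  · exact le_rfl
  · simpa using sq_nonneg (x j)

open Classical in
lemma card_support_truncate_le (T : Finset (Fin n)) (x : EuclideanSpace ℝ (Fin n)) :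
    (Finset.univ.filter fun j => truncate T x j ≠ 0).card ≤ T.card := by
  refine Finset.card_le_card fun j hj => ?_
  by_contra h
  simp [truncate_apply, h] at hj

open Classical in
/-- The coordinates of `x` of absolute value at least `a / √n`. -/
noncomputable def largeCoords (a : ℝ) (x : EuclideanSpace ℝ (Fin n)) : Finset (Fin n) :=
  Finset.univ.filter fun j => a / √(n : ℝ) ≤ |x j|

lemma mem_largeCoords {a : ℝ} {x : EuclideanSpace ℝ (Fin n)} {j : Fin n} :
    j ∈ largeCoords a x ↔ a / √(n : ℝ) ≤ |x j| := by simp [largeCoords]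

open Classical in
lemma sum_compl_largeCoords_le {a : ℝ} (x : EuclideanSpace ℝ (Fin n)) :
    ∑ j ∈ (largeCoords a x)ᶜ, x j ^ 2 ≤ a ^ 2 := by
  rcases Nat.eq_zero_or_pos n with rfl | hn
  · rw [Finset.sum_eq_zero fun j _ => j.elim0]
    exact sq_nonneg a
  have hn0 : (0 : ℝ) < n := by exact_mod_cast hn
  calc ∑ j ∈ (largeCoords a x)ᶜ, x j ^ 2 ≤ ∑ j ∈ (largeCoords a x)ᶜ, a ^ 2 / n := by
        refine Finset.sum_le_sum fun j hj => ?_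
        rw [Finset.mem_compl, mem_largeCoords, not_le] at hj
        rw [← sq_abs, ← Real.sq_sqrt hn0.le, ← div_pow]
        gcongr
    _ ≤ ∑ _j : Fin n, a ^ 2 / n :=
        Finset.sum_le_sum_of_subset_of_nonneg (Finset.subset_univ _) fun _ _ _ => by positivity
    _ = a ^ 2 := by simp; field_simp

lemma card_mul_le_sum_sq {a : ℝ} (ha : 0 ≤ a) (x : EuclideanSpace ℝ (Fin n))
    {s : Finset (Fin n)} (hs : s ⊆ largeCoords a x) : s.card * (a ^ 2 / n) ≤ ∑ j ∈ s, x j ^ 2 := by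
  rw [← nsmul_eq_mul]
  refine Finset.card_nsmul_le_sum _ _ _ fun j hj => ?_
  have h := mem_largeCoords.1 (hs hj)
  calc a ^ 2 / n = (a / √(n : ℝ)) ^ 2 := by rw [div_pow, Real.sq_sqrt (Nat.cast_nonneg n)]
    _ ≤ |x j| ^ 2 := by gcongr
    _ = x j ^ 2 := sq_abs _

end Truncation

/-! ### Nearly sparse vectors. -/

section SparseVectors

open Classical in
-- Averaging: the row variances sum to at least `θ n ‖y‖ ^ 2` and each is at most `‖y‖ ^ 2`.
lemma card_rowVar_ge {n : ℕ} {b : Matrix (Fin n) (Fin n) ℝ} (hb : ∀ i j, |b i j| ≤ 1) {θ : ℝ}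
    (hθ : 0 < θ) (hcol : ∀ j, θ * n ≤ ∑ i, b i j ^ 2) {y : EuclideanSpace ℝ (Fin n)}
    (hy : y ≠ 0) :
    θ / 2 * n ≤ (Finset.univ.filter fun i => θ / 2 * ‖y‖ ^ 2 ≤ rowVar b y i).card := by
  have hy0 : 0 < ‖y‖ ^ 2 := by positivity
  set S := Finset.univ.filter fun i => θ / 2 * ‖y‖ ^ 2 ≤ rowVar b y i with hS
  have h1 : θ * n * ‖y‖ ^ 2 ≤ ∑ i, rowVar b y i := by
    unfold rowVar
    rw [Finset.sum_comm, EuclideanSpace.real_norm_sq_eq, Finset.mul_sum]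
    refine Finset.sum_le_sum fun j _ => ?_
    simp_rw [mul_pow]
    rw [← Finset.sum_mul]
    exact mul_le_mul_of_nonneg_right (hcol j) (sq_nonneg _)
  have h2 : ∑ i, rowVar b y i ≤ S.card * ‖y‖ ^ 2 + n * (θ / 2 * ‖y‖ ^ 2) := by
    rw [← Finset.sum_add_sum_compl S]
    refine add_le_add ?_ ?_
    · rw [← nsmul_eq_mul]
      exact Finset.sum_le_card_nsmul _ _ _ fun i _ => rowVar_le_norm_sq hb y i
    · calc ∑ i ∈ Sᶜ, rowVar b y i ≤ Sᶜ.card • (θ / 2 * ‖y‖ ^ 2) :=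
            Finset.sum_le_card_nsmul _ _ _ fun i hi => by
              have : ¬ θ / 2 * ‖y‖ ^ 2 ≤ rowVar b y i := by simpa [hS] using hi
              exact (not_le.1 this).le
        _ ≤ n * (θ / 2 * ‖y‖ ^ 2) := by
            rw [nsmul_eq_mul]
            gcongr
            exact (Finset.card_le_univ _).trans (by simp)
  have h3 : θ / 2 * n * ‖y‖ ^ 2 ≤ S.card * ‖y‖ ^ 2 := by linarith
  exact le_of_mul_le_mul_right h3 hy0

open Classical in
/-- Nearly sparse vectors are unlikely to have a small image when the columns of the profile are
not degenerate. -/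
theorem exists_measure_small_image_nearly_sparse_le {θ : ℝ} (hθ : 0 < θ) :
    ∃ ε : ℝ, 0 < ε ∧ ∀ {n : ℕ}, 0 < n → ∀ {Ω : Type*} [MeasurableSpace Ω]
      {P : Measure Ω} {G : Ω → Matrix (Fin n) (Fin n) ℝ}, IsStdGaussianMatrix G P →
      ∀ b : Matrix (Fin n) (Fin n) ℝ, (∀ i j, |b i j| ≤ 1) → (∀ j, θ * n ≤ ∑ i, b i j ^ 2) →
      P.real (normBounded b G ∩ {ω | ∃ x : EuclideanSpace ℝ (Fin n), ‖x‖ = 1 ∧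
        (∃ T : Finset (Fin n), (T.card : ℝ) ≤ θ / 4 * n ∧ ∑ j ∈ Tᶜ, x j ^ 2 ≤ ε ^ 2) ∧
        ‖Matrix.toEuclideanLin (b ⊙ G ω) x‖ ≤ 8 * ε * √(n : ℝ)}) ≤ Real.exp (-n) := by
  -- Truncation keeps norm at least `1/2`, so `θ / 2 * n` entries have variance at least `θ / 8`:
  -- half of them pay for the sparsity `θ / 4 * n`, half are the margin `η n`.
  obtain ⟨ε, hε, hε2, -, key⟩ := exists_scale_measure_small_image_le (σ := √(θ / 8))
    (η := θ / 4) (a := 1 / 2) (by positivity) (by positivity) (by norm_num)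
  refine ⟨ε, hε, fun {n} hn Ω _ P G h b hb hcol => ?_⟩
  have := h.indep_entries.isProbabilityMeasure
  refine le_trans (measureReal_mono ?_ (measure_ne_top _ _)) (key hn h b ⌊θ / 4 * n⌋₊
    {y | 1 / 2 ≤ ‖y‖ ∧ ‖y‖ ≤ 1 ∧ (Finset.univ.filter fun j => y j ≠ 0).card ≤ ⌊θ / 4 * n⌋₊}
    (fun y hy => hy.2.1) (fun y hy => hy.2.2) ?_)
  · rintro ω ⟨hω, x, hx, ⟨T, hT, hxT⟩, hxω⟩
    refine ⟨hω, truncate T x, ⟨?_, ?_, ?_⟩, ?_⟩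
    all_goals have hd : ‖x - truncate T x‖ ≤ ε :=
      le_of_sq_le_sq (by rwa [norm_sub_truncate_sq]) hε.le
    · have := norm_sub_norm_le x (truncate T x)
      linarith
    · exact (norm_truncate_le _ _).trans hx.le
    · exact (card_support_truncate_le _ _).trans (Nat.le_floor hT)
    · have h1 := hω (x - truncate T x)
      calc ‖Matrix.toEuclideanLin (b ⊙ G ω) (truncate T x)‖
          = ‖Matrix.toEuclideanLin (b ⊙ G ω) x
              - Matrix.toEuclideanLin (b ⊙ G ω) (x - truncate T x)‖ := by rw [← map_sub]; simp
        _ ≤ 8 * ε * √(n : ℝ) + 8 * √(n : ℝ) * ‖x - truncate T x‖ :=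
            (norm_sub_le _ _).trans (add_le_add hxω h1)
        _ ≤ 8 * ε * √(n : ℝ) + 8 * √(n : ℝ) * ε := by gcongr
        _ = _ := by ring
  · rintro y ⟨hy, -, -⟩
    have h1 := card_rowVar_ge hb hθ hcol (y := y) (by rintro rfl; norm_num at hy)
    have h2 : ((⌊θ / 4 * n⌋₊ : ℕ) : ℝ) ≤ θ / 4 * n := Nat.floor_le (by positivity)
    calc _ ≤ θ / 2 * n := by linarith
      _ ≤ _ := h1
      _ ≤ _ := by
        gcongr with i
        rw [Real.sq_sqrt (by positivity)]
        have : (1 / 2) ^ 2 ≤ ‖y‖ ^ 2 := by gcongr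
        nlinarith

end SparseVectors

/-! ### Adjacency profiles and the equations for normal vectors. -/

namespace BipGraph

variable {n : ℕ}

open Classical in
lemma adjMatrix_apply (Γ : BipGraph n n) (j i : Fin n) :
    Γ.adjMatrix j i = if Γ.Adj j i then 1 else 0 := rfl

lemma abs_adjMatrix_le (Γ : BipGraph n n) (j i : Fin n) : |Γ.adjMatrix j i| ≤ 1 := by
  rw [adjMatrix_apply]; split_ifs <;> simp

lemma sum_sq_adjMatrix_left (Γ : BipGraph n n) (i : Fin n) :
    ∑ j, Γ.adjMatrix j i ^ 2 = Γ.degRight i := by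
  simp [adjMatrix_apply, degRight]

lemma sum_sq_adjMatrix_right (Γ : BipGraph n n) (j : Fin n) :
    ∑ i, Γ.adjMatrix j i ^ 2 = Γ.degLeft j := by
  simp [adjMatrix_apply, degLeft]

open Classical in
/-- The transposed adjacency matrix, with the rows of the right vertices in `R` set to `0`. -/
noncomputable def maskedTranspose (Γ : BipGraph n n) (R : Finset (Fin n)) : Matrix (Fin n) (Fin n) ℝ :=
  Matrix.of fun i j => if i ∈ R then 0 else Γ.adjMatrix j i

open Classical in
lemma maskedTranspose_apply (Γ : BipGraph n n) (R : Finset (Fin n)) (i j : Fin n) :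
    Γ.maskedTranspose R i j = if i ∈ R then 0 else Γ.adjMatrix j i := rfl

lemma abs_maskedTranspose_le (Γ : BipGraph n n) (R : Finset (Fin n)) (i j : Fin n) :
    |Γ.maskedTranspose R i j| ≤ 1 := by
  rw [maskedTranspose_apply]
  split_ifs
  · simp
  · exact Γ.abs_adjMatrix_le j i

lemma sum_sq_maskedTranspose_ge (Γ : BipGraph n n) (R : Finset (Fin n)) (j : Fin n) :
    (Γ.degLeft j : ℝ) - R.card ≤ ∑ i, Γ.maskedTranspose R i j ^ 2 := by
  classical
  rw [← sum_sq_adjMatrix_right, sub_le_iff_le_add, ← Finset.sum_add_sum_compl R,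
    ← Finset.sum_add_sum_compl R (fun i => Γ.maskedTranspose R i j ^ 2)]
  have h1 : ∑ i ∈ R, Γ.adjMatrix j i ^ 2 ≤ R.card := by
    rw [← nsmul_one]
    exact Finset.sum_le_card_nsmul _ _ _ fun i _ =>
      (sq_le_one_iff_abs_le_one _).2 (Γ.abs_adjMatrix_le j i)
  have h2 : ∑ i ∈ Rᶜ, Γ.maskedTranspose R i j ^ 2 = ∑ i ∈ Rᶜ, Γ.adjMatrix j i ^ 2 :=
    Finset.sum_congr rfl fun i hi => by
      rw [maskedTranspose_apply, if_neg (Finset.mem_compl.1 hi)]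
  have h3 : 0 ≤ ∑ i ∈ R, Γ.maskedTranspose R i j ^ 2 := Finset.sum_nonneg fun _ _ => sq_nonneg _
  linarith

open Classical in
lemma rowVar_transpose_ge (Γ : BipGraph n n) {a : ℝ} (ha : 0 ≤ a)
    {y : EuclideanSpace ℝ (Fin n)} {J : Finset (Fin n)} (hJ : J ⊆ largeCoords a y) (i : Fin n) :
    (J.filter fun j => Γ.Adj j i).card * (a ^ 2 / n) ≤ rowVar Γ.adjMatrixᵀ y i := by
  refine (card_mul_le_sum_sq ha y ((Finset.filter_subset _ _).trans hJ)).trans ?_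
  rw [rowVar, ← Finset.sum_add_sum_compl (J.filter fun j => Γ.Adj j i)]
  refine (Finset.sum_le_sum fun j hj => ?_).trans
    (le_add_of_nonneg_right (Finset.sum_nonneg fun _ _ => sq_nonneg _))
  rw [Matrix.transpose_apply, adjMatrix_apply, if_pos (Finset.mem_filter.1 hj).2, one_mul]

lemma rowVar_maskedTranspose_of_notMem (Γ : BipGraph n n) {R : Finset (Fin n)}
    (y : EuclideanSpace ℝ (Fin n)) {i : Fin n} (hi : i ∉ R) :
    rowVar (Γ.maskedTranspose R) y i = rowVar Γ.adjMatrixᵀ y i := by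
  simp [rowVar, maskedTranspose_apply, hi]

/-- The matrix of the linear equations that express orthogonality to the columns of `A ⊙ G` outside
`R`. -/
noncomputable def columnEquations (Γ : BipGraph n n) (R : Finset (Fin n)) (M : Matrix (Fin n) (Fin n) ℝ) :
    EuclideanSpace ℝ (Fin n) →ₗ[ℝ] EuclideanSpace ℝ (Fin n) :=
  Matrix.toEuclideanLin (Γ.maskedTranspose R ⊙ Mᵀ)

end BipGraph

/-! ### Expansion: normal vectors are spread. -/

section Spread

variable {δ κ : ℝ}

/-- One step of the expansion: the normal vectors with `β n` large coordinates have `β' n` of them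
at a smaller scale. -/
theorem exists_measure_expansion_step_le (hδ : 0 < δ) (hκ : 0 < κ) {β β' a ε₁ : ℝ} (hβ : 0 < β)
    (hβ' : 0 ≤ β') (hββ' : β' ≤ (1 + κ / 2) * β) (hβ'δ : β' ≤ 1 - δ / 2) (ha : 0 < a)
    (hε₁κ : ε₁ ≤ κ * β / 4) (hε₁δ : ε₁ ≤ δ / 4) :
    ∃ a' : ℝ, 0 < a' ∧ ∃ n₀ : ℕ, ∀ {n : ℕ}, n₀ ≤ n → ∀ {Ω : Type*} [MeasurableSpace Ω]
      {P : Measure Ω} {G : Ω → Matrix (Fin n) (Fin n) ℝ}, IsStdGaussianMatrix G P →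
      ∀ Γ : BipGraph n n, Γ.BroadlyConnected δ κ → ∀ R : Finset (Fin n), (R.card : ℝ) ≤ ε₁ * n →
      P.real (normBounded (Γ.maskedTranspose R) (fun ω => (G ω)ᵀ) ∩
        {ω | ∃ ν : EuclideanSpace ℝ (Fin n), ‖ν‖ = 1 ∧ Γ.columnEquations R (G ω) ν = 0 ∧
          β * n ≤ (largeCoords a ν).card ∧ ((largeCoords a' ν).card : ℝ) < β' * n})
        ≤ Real.exp (-n) := by
  classical
  set η := min (κ * β / 4) (δ / 4) with hη
  have hη0 : 0 < η := by positivity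
  obtain ⟨ε, hε, hεa, -, key⟩ := exists_scale_measure_small_image_le
    (σ := √(δ * β * a ^ 2 / 4)) (η := η) (a := a) (by positivity) hη0 ha
  obtain ⟨n₀, hn₀⟩ := exists_nat_ge (4 / (δ * β))
  refine ⟨ε, hε, n₀ + 1, fun {n} hn Ω _ P G h Γ hΓ R hR => ?_⟩
  have := h.indep_entries.isProbabilityMeasure
  have hn0 : 0 < n := by omega
  have hnR : (0 : ℝ) < n := by exact_mod_cast hn0
  have hnn₀ : 4 / (δ * β) ≤ n := hn₀.trans (by exact_mod_cast (by omega : n₀ ≤ n))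
  have hβn : 4 ≤ n * (δ * β) := by rwa [div_le_iff₀ (by positivity)] at hnn₀
  -- The family consists of truncations of `ν` at scale `ε`. As `ε ≤ a`, truncation keeps the `β n`
  -- coordinates that are large at scale `a`.
  refine le_trans (measureReal_mono ?_ (measure_ne_top _ _)) (key hn0 h.transpose
    (Γ.maskedTranspose R) ⌊β' * n⌋₊
    {y | ‖y‖ ≤ 1 ∧ (Finset.univ.filter fun j => y j ≠ 0).card ≤ ⌊β' * n⌋₊ ∧
      β * n ≤ (largeCoords a y).card} (fun y hy => hy.1) (fun y hy => hy.2.1) ?_)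
  · rintro ω ⟨hω, ν, hν, hker, hlarge, hsmall⟩
    refine ⟨hω, truncate (largeCoords ε ν) ν, ⟨?_, ?_, ?_⟩, ?_⟩
    · exact (norm_truncate_le _ _).trans hν.le
    · exact (card_support_truncate_le _ _).trans (Nat.le_floor hsmall.le)
    · refine hlarge.trans ?_
      gcongr
      intro j hj
      have h1 : j ∈ largeCoords ε ν := by
        rw [mem_largeCoords] at hj ⊢
        exact le_trans (by gcongr) hj
      rw [mem_largeCoords, truncate_apply, if_pos h1]
      exact mem_largeCoords.1 hj
    · have hd : ‖ν - truncate (largeCoords ε ν) ν‖ ≤ ε :=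
        le_of_sq_le_sq (by rw [norm_sub_truncate_sq]; exact sum_compl_largeCoords_le ν) hε.le
      -- Since `ν` is in the kernel, the truncation and the discarded tail have opposite images, and
      -- the tail has norm at most `ε`.
      have h1 := hω (ν - truncate (largeCoords ε ν) ν)
      rw [map_sub] at h1
      rw [BipGraph.columnEquations] at hker
      rw [hker, zero_sub, norm_neg] at h1
      refine h1.trans ?_
      calc 8 * √(n : ℝ) * ‖ν - truncate (largeCoords ε ν) ν‖ ≤ 8 * √(n : ℝ) * ε := by gcongr
        _ ≤ 16 * ε * √(n : ℝ) := by
          have : 0 ≤ ε * √(n : ℝ) := by positivity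
          linarith
  · rintro y ⟨-, -, hy⟩
    set J := largeCoords a y with hJ
    have hsub : Γ.broadNeighbors δ J \ R ⊆ Finset.univ.filter fun i =>
        √(δ * β * a ^ 2 / 4) ^ 2 ≤ rowVar (Γ.maskedTranspose R) y i := by
      intro i hi
      rw [Finset.mem_sdiff, BipGraph.broadNeighbors, Finset.mem_filter] at hi
      obtain ⟨⟨-, hi⟩, hiR⟩ := hi
      rw [Finset.mem_filter, Γ.rowVar_maskedTranspose_of_notMem y hiR,
        Real.sq_sqrt (by positivity)]
      refine ⟨Finset.mem_univ _, le_trans ?_ (Γ.rowVar_transpose_ge ha.le (J := J) subset_rfl i)⟩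
      have h1 : (⌊δ / 2 * (J.card : ℝ)⌋ : ℝ) ≤ ((J.filter fun j => Γ.Adj j i).card : ℝ) := by
        exact_mod_cast hi
      have h2 := Int.sub_one_lt_floor (δ / 2 * (J.card : ℝ))
      have h3 : δ / 2 * (β * n) ≤ δ / 2 * J.card := by gcongr
      -- The floor loses at most `1`, absorbed by `4 ≤ n * (δ * β)`.
      have h4 : δ * β / 4 * n ≤ ((J.filter fun j => Γ.Adj j i).card : ℝ) := by nlinarith
      calc δ * β * a ^ 2 / 4 = δ * β / 4 * n * (a ^ 2 / n) := by field_simp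
        _ ≤ _ := by gcongr
    have hcard : (((Γ.broadNeighbors δ J).card : ℝ) - R.card) ≤
        (Γ.broadNeighbors δ J \ R).card := by
      have := Finset.le_card_sdiff R (Γ.broadNeighbors δ J)
      rw [sub_le_iff_le_add]
      exact_mod_cast (by omega)
    have hb := hΓ.card_broadNeighbors_ge J
    have hfloor : ((⌊β' * n⌋₊ : ℕ) : ℝ) ≤ β' * n := Nat.floor_le (by positivity)
    have hfin : ((Γ.broadNeighbors δ J \ R).card : ℝ) ≤ (Finset.univ.filter fun i =>
        √(δ * β * a ^ 2 / 4) ^ 2 ≤ rowVar (Γ.maskedTranspose R) y i).card := by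
      exact_mod_cast Finset.card_le_card hsub
    refine le_trans ?_ hfin
    refine le_trans ?_ hcard
    have hηκ : η * n ≤ κ * β / 4 * n := by gcongr; exact min_le_left _ _
    have hηδ : η * n ≤ δ / 4 * n := by gcongr; exact min_le_right _ _
    have hRκ : (R.card : ℝ) ≤ κ * β / 4 * n := hR.trans (by gcongr)
    have hRδ : (R.card : ℝ) ≤ δ / 4 * n := hR.trans (by gcongr)
    -- The surplus over `β' n` is at least `κ β n / 2`, or `δ n / 2` when the neighbourhood is full;
    -- half pays for `R`, half for `η n`.
    rcases min_le_iff.1 hb with hb | hb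
    · have h1 : (1 + κ) * (β * n) ≤ (1 + κ) * J.card := by gcongr
      have h2 : β' * n ≤ (1 + κ / 2) * β * n := by gcongr
      linarith
    · have h2 : β' * n ≤ (1 - δ / 2) * n := by gcongr
      linarith

/-- The fraction of large coordinates after `s` expansion steps. -/
noncomputable def spreadLevel (δ κ : ℝ) (s : ℕ) : ℝ := min ((1 + κ / 2) ^ s * (δ / 8)) (1 - δ / 2)

lemma le_spreadLevel (hδ : 0 < δ) (hδ1 : δ ≤ 1) (hκ : 0 < κ) (s : ℕ) :
    δ / 8 ≤ spreadLevel δ κ s := by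
  refine le_min ?_ (by linarith)
  have : 1 ≤ (1 + κ / 2) ^ s := one_le_pow₀ (by linarith)
  nlinarith

lemma spreadLevel_succ_le (hδ1 : δ ≤ 1) (hκ : 0 < κ) (s : ℕ) :
    spreadLevel δ κ (s + 1) ≤ (1 + κ / 2) * spreadLevel δ κ s := by
  unfold spreadLevel
  rw [mul_min_of_nonneg _ _ (by linarith)]
  refine min_le_min ?_ ?_
  · rw [pow_succ]; linarith
  · nlinarith

lemma exists_spreadLevel_eq (hδ : 0 < δ) (hκ : 0 < κ) : ∃ s, spreadLevel δ κ s = 1 - δ / 2 := by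
  obtain ⟨s, hs⟩ := pow_unbounded_of_one_lt ((1 - δ / 2) / (δ / 8))
    (show 1 < 1 + κ / 2 by linarith)
  refine ⟨s, min_eq_right ?_⟩
  rw [div_lt_iff₀ (by positivity)] at hs
  exact hs.le

/-- Induction on the expansion steps: each costs one more `exp (-n)`, and a vector with too few
large coordinates at the start is nearly sparse. -/
theorem exists_measure_few_largeCoords_le (hδ : 0 < δ) (hδ1 : δ ≤ 1) (hκ : 0 < κ) {ε₁ : ℝ}
    (hε₁κ : ε₁ ≤ κ * (δ / 8) / 4) (hε₁δ : ε₁ ≤ δ / 4) (s : ℕ) :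
    ∃ a : ℝ, 0 < a ∧ ∃ n₀ : ℕ, ∀ {n : ℕ}, n₀ ≤ n → ∀ {Ω : Type*} [MeasurableSpace Ω]
      {P : Measure Ω} {G : Ω → Matrix (Fin n) (Fin n) ℝ}, IsStdGaussianMatrix G P →
      ∀ Γ : BipGraph n n, Γ.BroadlyConnected δ κ → ∀ R : Finset (Fin n), (R.card : ℝ) ≤ ε₁ * n →
      P.real (normBounded (Γ.maskedTranspose R) (fun ω => (G ω)ᵀ) ∩
        {ω | ∃ ν : EuclideanSpace ℝ (Fin n), ‖ν‖ = 1 ∧ Γ.columnEquations R (G ω) ν = 0 ∧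
          ((largeCoords a ν).card : ℝ) < spreadLevel δ κ s * n})
        ≤ (s + 1) * Real.exp (-n) := by
  classical
  induction s with
  | zero =>
    -- With `θ = δ / 2` the admissible sparsity `θ / 4` is the initial level `δ / 8`; masking `R`
    -- leaves column mass at least `δ n / 2`.
    obtain ⟨ε, hε, key⟩ := exists_measure_small_image_nearly_sparse_le (half_pos hδ)
    refine ⟨ε, hε, 1, fun {n} hn Ω _ P G h Γ hΓ R hR => ?_⟩
    have := h.indep_entries.isProbabilityMeasure
    have hnR : (0 : ℝ) < n := by exact_mod_cast hn
    have hcol : ∀ j, δ / 2 * n ≤ ∑ i, Γ.maskedTranspose R i j ^ 2 := fun j => by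
      refine le_trans ?_ (Γ.sum_sq_maskedTranspose_ge R j)
      have h1 := hΓ.degLeft_ge j
      have h2 : ε₁ * n ≤ δ / 4 * n := by gcongr
      nlinarith
    rw [Nat.cast_zero, zero_add, one_mul]
    refine le_trans (measureReal_mono ?_ (measure_ne_top _ _))
      (key hn h.transpose (Γ.maskedTranspose R) (Γ.abs_maskedTranspose_le R) hcol)
    rintro ω ⟨hω, ν, hν, hker, hsmall⟩
    refine ⟨hω, ν, hν, ⟨largeCoords ε ν, ?_, sum_compl_largeCoords_le ν⟩, ?_⟩
    · refine hsmall.le.trans ?_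
      gcongr
      exact (min_le_left _ _).trans (by simp; linarith)
    · rw [BipGraph.columnEquations] at hker
      rw [hker, norm_zero]
      positivity
  | succ s ih =>
    obtain ⟨a, ha, n₀, hs⟩ := ih
    have hl := le_spreadLevel hδ hδ1 hκ s
    obtain ⟨a', ha', n₁, hstep⟩ := exists_measure_expansion_step_le (β := spreadLevel δ κ s)
      (β' := spreadLevel δ κ (s + 1)) (ε₁ := ε₁) hδ hκ (by linarith)
      (by linarith [le_spreadLevel hδ hδ1 hκ (s + 1)])
      (spreadLevel_succ_le hδ1 hκ s) (min_le_right _ _) ha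
      (hε₁κ.trans (by gcongr)) hε₁δ
    refine ⟨a', ha', max n₀ n₁, fun {n} hn Ω _ P G h Γ hΓ R hR => ?_⟩
    have := h.indep_entries.isProbabilityMeasure
    have h0 := hs (le_of_max_le_left hn) h Γ hΓ R hR
    have h1 := hstep (le_of_max_le_right hn) h Γ hΓ R hR
    have hsub : normBounded (Γ.maskedTranspose R) (fun ω => (G ω)ᵀ) ∩
        {ω | ∃ ν : EuclideanSpace ℝ (Fin n), ‖ν‖ = 1 ∧ Γ.columnEquations R (G ω) ν = 0 ∧
          ((largeCoords a' ν).card : ℝ) < spreadLevel δ κ (s + 1) * n} ⊆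
        (normBounded (Γ.maskedTranspose R) (fun ω => (G ω)ᵀ) ∩
          {ω | ∃ ν : EuclideanSpace ℝ (Fin n), ‖ν‖ = 1 ∧ Γ.columnEquations R (G ω) ν = 0 ∧
            ((largeCoords a ν).card : ℝ) < spreadLevel δ κ s * n}) ∪
        (normBounded (Γ.maskedTranspose R) (fun ω => (G ω)ᵀ) ∩
          {ω | ∃ ν : EuclideanSpace ℝ (Fin n), ‖ν‖ = 1 ∧ Γ.columnEquations R (G ω) ν = 0 ∧
            spreadLevel δ κ s * n ≤ (largeCoords a ν).card ∧
            ((largeCoords a' ν).card : ℝ) < spreadLevel δ κ (s + 1) * n}) := by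
      rintro ω ⟨hω, ν, hν, hker, hsmall⟩
      rcases lt_or_ge ((largeCoords a ν).card : ℝ) (spreadLevel δ κ s * n) with hlt | hge
      · exact Or.inl ⟨hω, ν, hν, hker, hlt⟩
      · exact Or.inr ⟨hω, ν, hν, hker, hge, hsmall⟩
    refine (measureReal_mono hsub (measure_ne_top _ _)).trans
      ((measureReal_union_le _ _).trans ((add_le_add h0 h1).trans ?_))
    push_cast
    linarith

/-- The unit normal vectors of the span of most columns of `A ⊙ G` are spread: they put mass on the
neighbourhood of every right vertex. -/
theorem exists_measure_normal_not_spread_le (hδ : 0 < δ) (hδ1 : δ ≤ 1) (hκ : 0 < κ) :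
    ∃ ε₁ σ C : ℝ, 0 < ε₁ ∧ 0 < σ ∧ 0 < C ∧ ∃ n₀ : ℕ, ∀ {n : ℕ}, n₀ ≤ n →
      ∀ {Ω : Type*} [MeasurableSpace Ω]
      {P : Measure Ω} {G : Ω → Matrix (Fin n) (Fin n) ℝ}, IsStdGaussianMatrix G P →
      ∀ Γ : BipGraph n n, Γ.BroadlyConnected δ κ → ∀ R : Finset (Fin n), (R.card : ℝ) ≤ ε₁ * n →
      ∀ i : Fin n, P.real {ω | ∃ ν : EuclideanSpace ℝ (Fin n), ‖ν‖ = 1 ∧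
          Γ.columnEquations R (G ω) ν = 0 ∧ rowVar Γ.adjMatrixᵀ ν i ≤ σ ^ 2}
        ≤ C * Real.exp (-n) := by
  classical
  obtain ⟨s, hs⟩ := exists_spreadLevel_eq hδ hκ
  obtain ⟨a, ha, n₀, key⟩ := exists_measure_few_largeCoords_le hδ hδ1 hκ
    (ε₁ := min (κ * (δ / 8) / 4) (δ / 4)) (min_le_left _ _) (min_le_right _ _) s
  rw [hs] at key
  refine ⟨min (κ * (δ / 8) / 4) (δ / 4), √(δ * a ^ 2 / 4), s + 2, by positivity, by positivity,
    by positivity, n₀ + 1, fun {n} hn Ω _ P G h Γ hΓ R hR i => ?_⟩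
  have := h.indep_entries.isProbabilityMeasure
  have hnR : (0 : ℝ) < n := by exact_mod_cast (by omega : 0 < n)
  have h0 := key (by omega) h Γ hΓ R hR
  have h1 := measure_compl_normBounded_le h.transpose (Γ.abs_maskedTranspose_le R)
  refine (measureReal_mono (fun ω hω => ?_) (measure_ne_top _ _)).trans
    ((measureReal_union_le _ _).trans ((add_le_add h0 h1).trans (by linarith)))
  obtain ⟨ν, hν, hker, hvar⟩ := hω
  by_cases hop : ω ∈ normBounded (Γ.maskedTranspose R) (fun ω => (G ω)ᵀ)
  swap
  · exact Or.inr hop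
  refine Or.inl ⟨hop, ν, hν, hker, ?_⟩
  by_contra hcon
  rw [not_lt] at hcon
  have h2 := Γ.rowVar_transpose_ge ha.le (J := largeCoords a ν) subset_rfl i
  rw [Real.sq_sqrt (by positivity)] at hvar
  -- Inclusion-exclusion: sets of size `δ n` and `(1 - δ / 2) n` overlap in at least `δ n / 2`
  -- points.
  have h3 : δ / 2 * n ≤ ((largeCoords a ν).filter fun j => Γ.Adj j i).card := by
    have h4 := hΓ.degRight_ge i
    have h5 : Γ.degRight i + (largeCoords a ν).card ≤
        ((largeCoords a ν).filter fun j => Γ.Adj j i).card + n := by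
      have h6 := Finset.card_union_add_card_inter (Finset.univ.filter fun j => Γ.Adj j i)
        (largeCoords a ν)
      have h7 : (Finset.univ.filter fun j => Γ.Adj j i) ∩ largeCoords a ν
          = (largeCoords a ν).filter fun j => Γ.Adj j i := by
        ext j; simp [and_comm]
      have h8 : ((Finset.univ.filter fun j => Γ.Adj j i) ∪ largeCoords a ν).card ≤ n :=
        (Finset.card_le_univ _).trans (by simp)
      rw [h7] at h6
      unfold BipGraph.degRight
      omega
    have h9 : (Γ.degRight i : ℝ) + (largeCoords a ν).card ≤
        ((largeCoords a ν).filter fun j => Γ.Adj j i).card + n := by exact_mod_cast h5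
    linarith
  have h10 : δ * a ^ 2 / 2 ≤ δ * a ^ 2 / 4 := by
    calc δ * a ^ 2 / 2 = δ / 2 * n * (a ^ 2 / n) := by field_simp
      _ ≤ _ := mul_le_mul_of_nonneg_right h3 (by positivity)
      _ ≤ _ := h2.trans hvar
  have : 0 < δ * a ^ 2 := by positivity
  linarith

end Spread

/-! ### Joint law of the columns. -/

section ColumnLaw

variable {n : ℕ} {Ω : Type*} [MeasurableSpace Ω] {P : Measure Ω}
  {G : Ω → Matrix (Fin n) (Fin n) ℝ}

lemma IsStdGaussianMatrix.iIndepFun_columns (h : IsStdGaussianMatrix G P) :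
    iIndepFun (fun i ω j => G ω j i) P := by
  have hP := h.indep_entries.isProbabilityMeasure
  have h1 := hasGaussianLaw_family h.indep_entries (fun p => h.hasLaw_entry p.1 p.2)
  have h2 := h1.map_fun (ContinuousLinearMap.pi fun i : Fin n => ContinuousLinearMap.pi
    fun j : Fin n => ContinuousLinearMap.proj (R := ℝ) (φ := fun _ : Fin n × Fin n => ℝ) (j, i))
  refine HasGaussianLaw.iIndepFun_of_covariance_eval (X := fun i j ω => G ω j i) h2 ?_
  intro i k hik j l
  have hne : ((j, i) : Fin n × Fin n) ≠ (l, k) := fun he => hik (Prod.ext_iff.1 he).2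
  exact (h.indep_entries.indepFun hne).covariance_eq_zero
    (h.hasLaw_entry j i).hasGaussianLaw.memLp_two (h.hasLaw_entry l k).hasGaussianLaw.memLp_two

lemma IsStdGaussianMatrix.aemeasurable_column (h : IsStdGaussianMatrix G P) (i : Fin n) :
    AEMeasurable (fun ω j => G ω j i) P :=
  aemeasurable_pi_lambda _ fun j => (h.hasLaw_entry j i).aemeasurable

/-- The product form allows integrating over one column with the others frozen. -/
lemma IsStdGaussianMatrix.map_columns (h : IsStdGaussianMatrix G P) :
    P.map (fun ω i j => G ω j i)
      = Measure.pi fun _ : Fin n => Measure.pi fun _ : Fin n => gaussianReal 0 1 := by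
  rw [h.iIndepFun_columns.map_fun_eq_pi_map h.aemeasurable_column]
  congr 1
  ext1 i
  have h1 : iIndepFun (fun j ω => G ω j i) P :=
    h.indep_entries.precomp (g := fun j : Fin n => ((j, i) : Fin n × Fin n))
      fun _ _ he => (Prod.ext_iff.1 he).1
  rw [h1.map_fun_eq_pi_map fun j => (h.hasLaw_entry j i).aemeasurable]
  congr 1
  ext1 j
  exact (h.hasLaw_entry j i).map_eq

end ColumnLaw

/-! ### Small ball estimate for a Gaussian vector on a subspace. -/

section SubspaceSmallBall

lemma hasLaw_eval_pi_gaussianReal {ι : Type*} [Fintype ι] (p : ι) :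
    HasLaw (fun y : ι → ℝ => y p) (gaussianReal 0 1) (Measure.pi fun _ : ι => gaussianReal 0 1) :=
  ⟨(measurable_pi_apply p).aemeasurable,
    (measurePreserving_eval (fun _ : ι => gaussianReal 0 1) p).map_eq⟩

lemma iIndepFun_eval_pi_gaussianReal {ι : Type*} [Fintype ι] :
    iIndepFun (fun (p : ι) (y : ι → ℝ) => y p) (Measure.pi fun _ : ι => gaussianReal 0 1) := by
  rw [iIndepFun_iff_map_fun_eq_pi_map fun p => (measurable_pi_apply p).aemeasurable]
  simp_rw [fun p => (hasLaw_eval_pi_gaussianReal (ι := ι) p).map_eq]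
  exact Measure.map_id

lemma exists_orthonormal_of_le_finrank {E : Type*} [NormedAddCommGroup E] [InnerProductSpace ℝ E]
    (V : Submodule ℝ E) [FiniteDimensional ℝ V] {r : ℕ} (hr : r ≤ Module.finrank ℝ V) :
    ∃ e : Fin r → E, (∀ k, e k ∈ V) ∧ Orthonormal ℝ e := by
  have h := (stdOrthonormalBasis ℝ V).orthonormal.comp (Fin.castLE hr) (Fin.castLE_injective hr)
  exact ⟨fun k => (stdOrthonormalBasis ℝ V (Fin.castLE hr k) : E), fun k => Subtype.coe_prop _,
    h.comp_linearIsometry V.subtypeₗᵢ⟩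

lemma sum_mul_eq_inner {n : ℕ} (x y : EuclideanSpace ℝ (Fin n)) :
    ∑ j, x j * y j = inner ℝ x y := by
  rw [PiLp.inner_apply]
  exact Finset.sum_congr rfl fun j _ => by simp only [RCLike.inner_apply, conj_trivial]; ring

/-- A Gaussian vector with independent entries of variance `a j ^ 2` has small projection to a
subspace `W` with small probability when its covariance is nondegenerate on `W`. -/
lemma measure_pairing_subspace_le {n r : ℕ} (a : Fin n → ℝ)
    (W : Submodule ℝ (EuclideanSpace ℝ (Fin n))) (hr : r ≤ Module.finrank ℝ W) {σ u : ℝ}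
    (hσ : 0 < σ) (hu : 0 < u) (hW : ∀ ν ∈ W, ‖ν‖ = 1 → σ ^ 2 < ∑ j, (a j * ν j) ^ 2) :
    (Measure.pi fun _ : Fin n => gaussianReal 0 1).real
      {y | ∀ ν ∈ W, ‖ν‖ = 1 → |∑ j, a j * ν j * y j| ≤ u} ≤ (2 * u / (σ * √(r : ℝ))) ^ r := by
  set D : EuclideanSpace ℝ (Fin n) →ₗ[ℝ] EuclideanSpace ℝ (Fin n) :=
    Matrix.toEuclideanLin (Matrix.diagonal a) with hD
  have hDapp : ∀ ν j, D ν j = a j * ν j := fun ν j => by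
    simp [hD, Matrix.toLpLin_apply, Matrix.mulVec_diagonal]
  have hDnorm : ∀ ν ∈ W, σ * ‖ν‖ ≤ ‖D ν‖ := by
    intro ν hν
    rcases eq_or_ne ν 0 with rfl | h0
    · simp
    have hpos : 0 < ‖ν‖ := norm_pos_iff.2 h0
    have h1 := hW (‖ν‖⁻¹ • ν) (W.smul_mem _ hν) (by simp [norm_smul, hpos.ne'])
    have h2 : ∑ j, (a j * (‖ν‖⁻¹ • ν) j) ^ 2 = ‖ν‖⁻¹ ^ 2 * ‖D ν‖ ^ 2 := by
      rw [EuclideanSpace.real_norm_sq_eq (D ν), Finset.mul_sum]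
      refine Finset.sum_congr rfl fun j _ => ?_
      rw [hDapp]; simp; ring
    rw [h2] at h1
    refine le_of_sq_le_sq ?_ (norm_nonneg _)
    rw [mul_pow]
    calc σ ^ 2 * ‖ν‖ ^ 2 ≤ ‖ν‖⁻¹ ^ 2 * ‖D ν‖ ^ 2 * ‖ν‖ ^ 2 := by gcongr
      _ = _ := by field_simp
  have hinj : Function.Injective (D.domRestrict W) := by
    rw [← LinearMap.ker_eq_bot, LinearMap.ker_eq_bot']
    intro w hw
    have h1 := hDnorm w w.2
    rw [LinearMap.domRestrict_apply] at hw
    rw [hw, norm_zero] at h1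
    have h2 : ‖(w : EuclideanSpace ℝ (Fin n))‖ ≤ 0 := by
      by_contra! hc
      nlinarith [mul_pos hσ hc]
    exact Subtype.ext (norm_le_zero_iff.1 h2)
  set V := W.map D with hV
  have hfin : Module.finrank ℝ V = Module.finrank ℝ W := by
    rw [hV, ← LinearMap.range_domRestrict]
    exact LinearMap.finrank_range_of_inj hinj
  obtain ⟨e, heV, heo⟩ := exists_orthonormal_of_le_finrank V (hr.trans_eq hfin.symm)
  have hinner : ∀ k l, ∑ p, e k p * e l p = if k = l then 1 else 0 := fun k l => by
    rw [sum_mul_eq_inner, orthonormal_iff_ite.1 heo k l]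
  have key := measure_sum_sq_linComb_le iIndepFun_eval_pi_gaussianReal
    (fun p : Fin n => hasLaw_eval_pi_gaussianReal p) (c := fun k p => e k p)
    (fun k l hkl => by rw [hinner, if_neg hkl]) Finset.univ one_pos (S := u / σ)
    (fun k _ => by simp_rw [sq]; rw [hinner, if_pos rfl]; norm_num) (by positivity)
  rw [Finset.card_univ, Fintype.card_fin] at key
  have hrw : 2 * (u / σ) / (1 * √(r : ℝ)) = 2 * u / (σ * √(r : ℝ)) := by
    rw [one_mul, mul_div_assoc', div_div]
  rw [hrw] at key
  refine le_trans (measureReal_mono ?_ (measure_ne_top _ _)) key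
  intro y hy
  simp only [Set.mem_ofPred_eq] at hy ⊢
  set x : Fin r → ℝ := fun k => linComb (fun p (y : Fin n → ℝ) => y p) (fun k p => e k p) k y
    with hx
  -- `v` is the projection of `y` to the span of the `e k`. Writing `v = D w` and testing on `w /
  -- ‖w‖` gives `‖v‖ ^ 2 ≤ u ‖w‖ ≤ u ‖v‖ / σ`.
  set v : EuclideanSpace ℝ (Fin n) := ∑ k, x k • e k with hv
  have hvV : v ∈ V := V.sum_mem fun k _ => V.smul_mem _ (heV k)
  have hvnorm : ‖v‖ ^ 2 = ∑ k, x k ^ 2 := by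
    rw [← real_inner_self_eq_norm_sq, hv, heo.inner_sum]
    exact Finset.sum_congr rfl fun k _ => by rw [conj_trivial, sq]
  have hvy : ∑ j, v j * y j = ‖v‖ ^ 2 := by
    rw [hvnorm]
    have : ∀ j, v j = ∑ k, x k * e k j := fun j => by
      rw [hv, WithLp.ofLp_sum, Finset.sum_apply]
      rfl
    simp_rw [this, Finset.sum_mul]
    rw [Finset.sum_comm]
    refine Finset.sum_congr rfl fun k _ => ?_
    simp_rw [mul_assoc]
    rw [← Finset.mul_sum, sq]
    rfl
  obtain ⟨w, hwW, hwv⟩ := Submodule.mem_map.1 hvV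
  change ∑ k, x k ^ 2 ≤ _
  rw [← hvnorm]
  have hvw : ‖v‖ ^ 2 ≤ u * ‖w‖ := by
    rcases eq_or_ne w 0 with rfl | h0
    · have : v = 0 := by rw [← hwv, map_zero]
      simp [this]
    have hpos : 0 < ‖w‖ := norm_pos_iff.2 h0
    have h1 := hy (‖w‖⁻¹ • w) (W.smul_mem _ hwW) (by simp [norm_smul, hpos.ne'])
    have h2 : ∑ j, a j * (‖w‖⁻¹ • w) j * y j = ‖w‖⁻¹ * ‖v‖ ^ 2 := by
      rw [← hvy, Finset.mul_sum]
      refine Finset.sum_congr rfl fun j _ => ?_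
      rw [← hwv, hDapp]; simp; ring
    rw [h2] at h1
    have h3 := (le_abs_self _).trans h1
    rwa [inv_mul_le_iff₀ hpos, mul_comm] at h3
  have hwle : σ * ‖w‖ ≤ ‖v‖ := by
    have := hDnorm w hwW
    rwa [hwv] at this
  have h4 : ‖v‖ ≤ u / σ := by
    rw [le_div_iff₀ hσ]
    rcases (norm_nonneg v).eq_or_lt with h0 | hpos
    · rw [← h0, zero_mul]; exact hu.le
    · have : ‖v‖ * (‖v‖ * σ) ≤ ‖v‖ * u := by nlinarith
      exact le_of_mul_le_mul_left this hpos
  gcongr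

end SubspaceSmallBall

/-! ### One column against the normals of the others. -/

section ColumnSmallBall

variable {n : ℕ}

lemma BipGraph.columnEquations_eq_zero_iff (Γ : BipGraph n n) (R : Finset (Fin n))
    (M : Matrix (Fin n) (Fin n) ℝ) (ν : EuclideanSpace ℝ (Fin n)) :
    Γ.columnEquations R M ν = 0 ↔ ∀ k ∉ R, ∑ j, Γ.adjMatrix j k * ν j * M j k = 0 := by
  classical
  rw [PiLp.ext_iff]
  refine forall_congr' fun k => ?_
  rw [BipGraph.columnEquations, toEuclideanLin_hadamard_apply]
  by_cases hk : k ∈ R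
  · simp [BipGraph.maskedTranspose_apply, hk]
  · simp [BipGraph.maskedTranspose_apply, hk]

/-- Only `n - |R|` equations are not identically zero. -/
lemma BipGraph.card_le_finrank_ker_columnEquations (Γ : BipGraph n n) (R : Finset (Fin n))
    (M : Matrix (Fin n) (Fin n) ℝ) :
    R.card ≤ Module.finrank ℝ (LinearMap.ker (Γ.columnEquations R M)) := by
  classical
  set L : EuclideanSpace ℝ (Fin n) →ₗ[ℝ] ({k // k ∈ Rᶜ} → ℝ) :=
    LinearMap.pi fun k => (EuclideanSpace.proj (k : Fin n)).toLinearMap ∘ₗ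
      Γ.columnEquations R M with hL
  have hker : LinearMap.ker L = LinearMap.ker (Γ.columnEquations R M) := by
    ext ν
    rw [LinearMap.mem_ker, LinearMap.mem_ker, Γ.columnEquations_eq_zero_iff, funext_iff]
    simp only [hL, Subtype.forall, Finset.mem_compl]
    refine forall₂_congr fun k hk => ?_
    simp only [LinearMap.pi_apply, LinearMap.comp_apply, Pi.zero_apply]
    change Γ.columnEquations R M ν k = 0 ↔ _
    rw [BipGraph.columnEquations, toEuclideanLin_hadamard_apply]
    simp [BipGraph.maskedTranspose_apply, hk]
  have h1 := L.finrank_range_add_finrank_ker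
  have h2 := Submodule.finrank_le (LinearMap.range L)
  rw [hker, finrank_euclideanSpace_fin] at h1
  rw [Module.finrank_fintype_fun_eq_card, Fintype.card_coe, Finset.card_compl,
    Fintype.card_fin] at h2
  have h3 : R.card ≤ n := by simpa using Finset.card_le_univ R
  omega

/-- The matrices, given by their columns, for which the unit normal vectors of the columns of
`A ⊙ M` outside `R` put mass on the neighbourhood of `i`, but are almost orthogonal to the `i`-th
column. -/
def columnEvent (Γ : BipGraph n n) (R : Finset (Fin n)) (i : Fin n) (σ u : ℝ) :
    Set (Fin n → Fin n → ℝ) :=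
  {C | (∀ ν : EuclideanSpace ℝ (Fin n), ‖ν‖ = 1 → Γ.columnEquations R (Matrix.of C)ᵀ ν = 0 →
      σ ^ 2 < rowVar Γ.adjMatrixᵀ ν i) ∧
    ∀ ν : EuclideanSpace ℝ (Fin n), ‖ν‖ = 1 → Γ.columnEquations R (Matrix.of C)ᵀ ν = 0 →
      |∑ j, Γ.adjMatrix j i * ν j * C i j| ≤ u}

/-- Projection along the compact unit sphere is a closed map. This makes `columnEvent` measurable.
-/
lemma isClosed_exists_unit {X : Type*} [TopologicalSpace X]
    {S : Set (EuclideanSpace ℝ (Fin n) × X)} (hS : IsClosed S) :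
    IsClosed {C | ∃ ν : EuclideanSpace ℝ (Fin n), ‖ν‖ = 1 ∧ (ν, C) ∈ S} := by
  have h1 : IsClosed ((fun p : Metric.sphere (0 : EuclideanSpace ℝ (Fin n)) 1 × X =>
      ((p.1 : EuclideanSpace ℝ (Fin n)), p.2)) ⁻¹' S) := hS.preimage (by fun_prop)
  have h2 := isClosedMap_snd_of_compactSpace _ h1
  convert h2 using 1
  ext C
  constructor
  · rintro ⟨ν, hν, hS⟩
    exact ⟨(⟨ν, by simp [hν]⟩, C), hS, rfl⟩
  · rintro ⟨⟨ν, C'⟩, hS, rfl⟩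
    exact ⟨ν, by simp, hS⟩

lemma isClosed_columnEquations_eq_zero (Γ : BipGraph n n) (R : Finset (Fin n)) :
    IsClosed {p : EuclideanSpace ℝ (Fin n) × (Fin n → Fin n → ℝ) |
      Γ.columnEquations R (Matrix.of p.2)ᵀ p.1 = 0} := by
  simp_rw [Γ.columnEquations_eq_zero_iff, Set.ofPred_forall]
  refine isClosed_iInter fun k => isClosed_iInter fun _ => isClosed_eq ?_ continuous_const
  simp only [Matrix.transpose_apply, Matrix.of_apply]
  fun_prop

lemma measurableSet_columnEvent (Γ : BipGraph n n) (R : Finset (Fin n)) (i : Fin n) (σ u : ℝ) :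
    MeasurableSet (columnEvent Γ R i σ u) := by
  have hZ := isClosed_columnEquations_eq_zero Γ R
  have h1 := isClosed_exists_unit (hZ.inter (isClosed_le (f := fun p :
    EuclideanSpace ℝ (Fin n) × (Fin n → Fin n → ℝ) => rowVar Γ.adjMatrixᵀ p.1 i)
    (g := fun _ => σ ^ 2) (by unfold rowVar; fun_prop) continuous_const))
  -- The strict condition `> u` is a countable union of closed conditions.
  have h2 := fun m : ℕ => isClosed_exists_unit (hZ.inter (isClosed_le (f := fun _ :
    EuclideanSpace ℝ (Fin n) × (Fin n → Fin n → ℝ) => u + 1 / ((m : ℝ) + 1))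
    (g := fun p => |∑ j, Γ.adjMatrix j i * p.1 j * p.2 i j|) continuous_const (by fun_prop)))
  have h3 := (h1.measurableSet.union (MeasurableSet.iUnion fun m => (h2 m).measurableSet)).compl
  convert h3 using 1
  ext C
  rw [columnEvent, Set.mem_compl_iff, Set.mem_union, not_or, Set.mem_iUnion, not_exists]
  simp only [Set.mem_ofPred_eq, Set.mem_inter_iff, not_exists, not_and, not_le]
  refine and_congr Iff.rfl ⟨fun h m ν hν hz => ?_, fun h ν hν hz => ?_⟩
  · have : (0 : ℝ) < 1 / ((m : ℝ) + 1) := by positivity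
    linarith [h ν hν hz]
  · refine le_of_forall_pos_lt_add fun ε hε => ?_
    obtain ⟨m, hm⟩ := exists_nat_one_div_lt hε
    linarith [h m ν hν hz]

lemma columnEquations_update (Γ : BipGraph n n) {R : Finset (Fin n)} {i : Fin n} (hi : i ∈ R)
    (C : Fin n → Fin n → ℝ) (y : Fin n → ℝ) (ν : EuclideanSpace ℝ (Fin n)) :
    Γ.columnEquations R (Matrix.of (Function.update C i y))ᵀ ν = 0 ↔
      Γ.columnEquations R (Matrix.of C)ᵀ ν = 0 := by
  rw [Γ.columnEquations_eq_zero_iff, Γ.columnEquations_eq_zero_iff]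
  refine forall₂_congr fun k hk => ?_
  have : k ≠ i := fun h => hk (h ▸ hi)
  simp [Function.update_of_ne this]

/-- Fubini over the `i`-th column: as `i ∈ R`, the normals and the spread condition do not depend on
it. Each slice is either empty or covered by `measure_pairing_subspace_le`. -/
lemma pi_columnEvent_le (Γ : BipGraph n n) {R : Finset (Fin n)} {i : Fin n} (hi : i ∈ R)
    {σ u : ℝ} (hσ : 0 < σ) (hu : 0 < u) :
    (Measure.pi fun _ : Fin n => Measure.pi fun _ : Fin n => gaussianReal 0 1)
      (columnEvent Γ R i σ u) ≤ ENNReal.ofReal ((2 * u / (σ * √(R.card : ℝ))) ^ R.card) := by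
  classical
  have hmeas := measurableSet_columnEvent Γ R i σ u
  set μ : Fin n → Measure (Fin n → ℝ) := fun _ => Measure.pi fun _ : Fin n => gaussianReal 0 1
  set B := ENNReal.ofReal ((2 * u / (σ * √(R.card : ℝ))) ^ R.card)
  have hmarg : ∫⋯∫⁻_{i}, (columnEvent Γ R i σ u).indicator 1 ∂μ ≤ ∫⋯∫⁻_{i}, (fun _ => B) ∂μ := by
    intro C
    rw [lmarginal_singleton, lmarginal_singleton]
    simp only [lintegral_const, measure_univ, mul_one]
    have hset : (fun y => (columnEvent Γ R i σ u).indicator (1 : (Fin n → Fin n → ℝ) → ENNReal)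
        (Function.update C i y)) = ((Function.update C i) ⁻¹' columnEvent Γ R i σ u).indicator 1 :=
      rfl
    rw [hset, lintegral_indicator_one (hmeas.preimage (measurable_update C))]
    by_cases hW : ∀ ν ∈ LinearMap.ker (Γ.columnEquations R (Matrix.of C)ᵀ), ‖ν‖ = 1 →
        σ ^ 2 < ∑ j, (Γ.adjMatrix j i * ν j) ^ 2
    · have key := measure_pairing_subspace_le (fun j => Γ.adjMatrix j i)
        (LinearMap.ker (Γ.columnEquations R (Matrix.of C)ᵀ))
        (Γ.card_le_finrank_ker_columnEquations R _) hσ hu hW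
      have hsub : (Function.update C i) ⁻¹' columnEvent Γ R i σ u ⊆
          {y | ∀ ν ∈ LinearMap.ker (Γ.columnEquations R (Matrix.of C)ᵀ), ‖ν‖ = 1 →
            |∑ j, Γ.adjMatrix j i * ν j * y j| ≤ u} := by
        intro y hy ν hν hν1
        have := hy.2 ν hν1 ((columnEquations_update Γ hi C y ν).2 hν)
        simpa using this
      refine (measure_mono hsub).trans ?_
      rw [← ofReal_measureReal (measure_ne_top _ _)]
      exact ENNReal.ofReal_le_ofReal key
    · have : (Function.update C i) ⁻¹' columnEvent Γ R i σ u = ∅ := by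
        rw [Set.eq_empty_iff_forall_notMem]
        intro y hy
        exact hW fun ν hν hν1 => hy.1 ν hν1 ((columnEquations_update Γ hi C y ν).2 hν)
      rw [this, measure_empty]
      exact zero_le
  have h1 := lintegral_le_of_lmarginal_le {i} ((measurable_one.indicator hmeas))
    measurable_const hmarg
  rw [lintegral_indicator_one hmeas] at h1
  simpa using h1

theorem measure_column_nearly_orthogonal_le {Ω : Type*} [MeasurableSpace Ω] {P : Measure Ω}
    {G : Ω → Matrix (Fin n) (Fin n) ℝ} (h : IsStdGaussianMatrix G P) (Γ : BipGraph n n)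
    {R : Finset (Fin n)} {i : Fin n} (hi : i ∈ R) {σ u : ℝ} (hσ : 0 < σ) (hu : 0 < u) :
    P.real {ω | (∀ ν : EuclideanSpace ℝ (Fin n), ‖ν‖ = 1 → Γ.columnEquations R (G ω) ν = 0 →
        σ ^ 2 < rowVar Γ.adjMatrixᵀ ν i) ∧
      ∀ ν : EuclideanSpace ℝ (Fin n), ‖ν‖ = 1 → Γ.columnEquations R (G ω) ν = 0 →
        |∑ j, Γ.adjMatrix j i * ν j * G ω j i| ≤ u}
      ≤ (2 * u / (σ * √(R.card : ℝ))) ^ R.card := by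
  have hm : AEMeasurable (fun ω i j => G ω j i) P :=
    aemeasurable_pi_lambda _ fun i => h.aemeasurable_column i
  refine ENNReal.toReal_le_of_le_ofReal (by positivity) ?_
  refine (Measure.le_map_apply hm (columnEvent Γ R i σ u)).trans ?_
  rw [h.map_columns]
  exact pi_columnEvent_le Γ hi hσ hu

end ColumnSmallBall

/-! ### From a small singular value to nearly orthogonal columns. -/

section SmallSingularValues

variable {n : ℕ}

lemma le_finrank_ker_pi_add_card {ι E : Type*} [Fintype ι] [AddCommGroup E] [Module ℝ E]
    [FiniteDimensional ℝ E] (φ : ι → E →ₗ[ℝ] ℝ) :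
    Module.finrank ℝ E ≤ Module.finrank ℝ (LinearMap.ker (LinearMap.pi φ)) + Fintype.card ι := by
  have h1 := (LinearMap.pi φ).finrank_range_add_finrank_ker
  have h2 := Submodule.finrank_le (LinearMap.range (LinearMap.pi φ))
  rw [Module.finrank_fintype_fun_eq_card] at h2
  omega

lemma norm_sq_eq_sum_eigenvalues
    (T : EuclideanSpace ℝ (Fin n) →ₗ[ℝ] EuclideanSpace ℝ (Fin n)) (x : EuclideanSpace ℝ (Fin n)) :
    ‖T x‖ ^ 2 = ∑ j : Fin n, T.singularValues j ^ 2 *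
      (T.isSymmetric_adjoint_comp_self.eigenvectorBasis finrank_euclideanSpace_fin).repr x j ^ 2 := by
  set b := T.isSymmetric_adjoint_comp_self.eigenvectorBasis
    (finrank_euclideanSpace_fin (𝕜 := ℝ) (n := n)) with hb
  have h1 : ‖T x‖ ^ 2 = inner ℝ x ((LinearMap.adjoint T ∘ₗ T) x) := by
    rw [LinearMap.comp_apply, LinearMap.adjoint_inner_right, real_inner_self_eq_norm_sq]
  rw [h1, ← b.repr.inner_map_map, ← sum_mul_eq_inner]
  refine Finset.sum_congr rfl fun j _ => ?_
  rw [T.isSymmetric_adjoint_comp_self.eigenvectorBasis_apply_self_apply,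
    T.sq_singularValues_fin finrank_euclideanSpace_fin j]
  simp only [RCLike.ofReal_real_eq_id, id_eq]
  ring

/-- There is a subspace of dimension at least `n - s - |I|` of vectors that vanish on `I` and are
mapped with norm at most the `(s + 1)`-th singular value. -/
lemma exists_submodule_norm_le_singularValues
    (T : EuclideanSpace ℝ (Fin n) →ₗ[ℝ] EuclideanSpace ℝ (Fin n)) {s : ℕ} (hs : s ≤ n)
    (I : Finset (Fin n)) :
    ∃ W : Submodule ℝ (EuclideanSpace ℝ (Fin n)), n ≤ Module.finrank ℝ W + (s + I.card) ∧
      (∀ x ∈ W, ‖T x‖ ≤ T.singularValues s * ‖x‖) ∧ ∀ x ∈ W, ∀ i ∈ I, x i = 0 := by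
  set b := T.isSymmetric_adjoint_comp_self.eigenvectorBasis
    (finrank_euclideanSpace_fin (𝕜 := ℝ) (n := n)) with hb
  set φ : Fin s ⊕ I → EuclideanSpace ℝ (Fin n) →ₗ[ℝ] ℝ := Sum.elim
    (fun k => (EuclideanSpace.proj (Fin.castLE hs k)).toLinearMap ∘ₗ
      b.repr.toLinearEquiv.toLinearMap)
    (fun i => (EuclideanSpace.proj (i : Fin n)).toLinearMap) with hφ
  have hmem : ∀ x, x ∈ LinearMap.ker (LinearMap.pi φ) ↔ ∀ k, φ k x = 0 := fun x => by
    rw [LinearMap.mem_ker, funext_iff]; rfl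
  refine ⟨LinearMap.ker (LinearMap.pi φ), ?_, ?_, ?_⟩
  · have := le_finrank_ker_pi_add_card φ
    simpa using this
  · intro x hx
    rw [hmem] at hx
    have hzero : ∀ j : Fin n, (j : ℕ) < s → b.repr x j = 0 := fun j hj => hx (Sum.inl ⟨j, hj⟩)
    refine le_of_sq_le_sq ?_ (mul_nonneg (T.singularValues_nonneg s) (norm_nonneg _))
    rw [norm_sq_eq_sum_eigenvalues, mul_pow, ← b.repr.norm_map x, EuclideanSpace.real_norm_sq_eq,
      Finset.mul_sum]
    refine Finset.sum_le_sum fun j _ => ?_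
    rcases lt_or_ge (j : ℕ) s with hj | hj
    · simp [← hb, hzero j hj]
    · have h1 := T.singularValues_antitone hj
      have h2 := T.singularValues_nonneg j
      gcongr
  · intro x hx i hi
    exact (hmem x).1 hx (Sum.inr ⟨i, hi⟩)

lemma inner_toEuclideanLin_hadamard (A N : Matrix (Fin n) (Fin n) ℝ)
    (x ν : EuclideanSpace ℝ (Fin n)) :
    inner ℝ (Matrix.toEuclideanLin (A ⊙ N) x) ν = ∑ i, x i * ∑ j, A j i * ν j * N j i := by
  rw [← sum_mul_eq_inner]
  simp_rw [toEuclideanLin_hadamard_apply, Finset.sum_mul, Finset.mul_sum]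
  rw [Finset.sum_comm]
  exact Finset.sum_congr rfl fun i _ => Finset.sum_congr rfl fun j _ => by ring

open Classical in
/-- If a singular value is small, then many columns are nearly orthogonal to the unit normal vectors
of most of the other columns. -/
lemma card_nearly_orthogonal_columns_gt (Γ : BipGraph n n) (N : Matrix (Fin n) (Fin n) ℝ)
    {s r : ℕ} (I : Finset (Fin n)) (hr : 0 < r) (hsr : s + I.card + r ≤ n) {ρ γ α : ℝ}
    (hγ : 0 < γ) (hρ : (Matrix.toEuclideanLin (Γ.adjMatrix ⊙ N)).singularValues s ≤ ρ)
    (hspread : ∀ x : EuclideanSpace ℝ (Fin n), ‖x‖ = 1 →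
      ‖Matrix.toEuclideanLin (Γ.adjMatrix ⊙ N) x‖ ≤ ρ →
      ∀ T : Finset (Fin n), (T.card : ℝ) ≤ α * n → γ ^ 2 < ∑ j ∈ Tᶜ, x j ^ 2) :
    α * n < (Finset.univ.filter fun i => i ∉ I ∧ ∀ ν : EuclideanSpace ℝ (Fin n), ‖ν‖ = 1 →
      Γ.columnEquations (insert i I) N ν = 0 →
      |∑ j, Γ.adjMatrix j i * ν j * N j i| ≤ ρ * √(n : ℝ) / (γ * √(r : ℝ))).card := by
  set M := Matrix.toEuclideanLin (Γ.adjMatrix ⊙ N) with hM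
  obtain ⟨W, hdim, hWM, hWI⟩ := exists_submodule_norm_le_singularValues M (s := s) (by omega) I
  obtain ⟨e, heW, heo⟩ := exists_orthonormal_of_le_finrank W (r := r) (by omega)
  have hWρ : ∀ x ∈ W, ‖M x‖ ≤ ρ * ‖x‖ := fun x hx => (hWM x hx).trans (by gcongr)
  have hn : (0 : ℝ) < n := by exact_mod_cast (by omega : 0 < n)
  have hr0 : (0 : ℝ) < r := by exact_mod_cast hr
  -- `h i` is the squared norm of the projection of the `i`-th basis vector to the span of the `e
  -- k`; the vector `x` below is that projection.
  set h : Fin n → ℝ := fun i => ∑ k, e k i ^ 2 with hh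
  set T := Finset.univ.filter fun i => γ ^ 2 * r / n ≤ h i with hT
  have hTcard : α * n < T.card := by
    by_contra! hcon
    have h1 : ∀ k, γ ^ 2 < ∑ j ∈ Tᶜ, e k j ^ 2 := fun k =>
      hspread (e k) (heo.1 k) (by simpa [heo.1 k] using hWρ (e k) (heW k)) T hcon
    have h2 : r * γ ^ 2 < ∑ k, ∑ j ∈ Tᶜ, e k j ^ 2 := by
      have : ∑ _k : Fin r, γ ^ 2 < ∑ k, ∑ j ∈ Tᶜ, e k j ^ 2 :=
        Finset.sum_lt_sum_of_nonempty ⟨⟨0, hr⟩, Finset.mem_univ _⟩ fun k _ => h1 k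
      simpa using this
    rw [Finset.sum_comm] at h2
    have h3 : ∑ j ∈ Tᶜ, ∑ k, e k j ^ 2 ≤ n * (γ ^ 2 * r / n) := by
      calc ∑ j ∈ Tᶜ, ∑ k, e k j ^ 2 ≤ Tᶜ.card • (γ ^ 2 * r / n) :=
            Finset.sum_le_card_nsmul _ _ _ fun j hj => by
              have : ¬ γ ^ 2 * r / n ≤ h j := by simpa [hT] using hj
              exact (not_le.1 this).le
        _ ≤ n * (γ ^ 2 * r / n) := by
            rw [nsmul_eq_mul]
            gcongr
            exact (Finset.card_le_univ _).trans (by simp)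
    have h4 : n * (γ ^ 2 * r / n) = r * γ ^ 2 := by field_simp
    linarith
  refine hTcard.trans_le ?_
  norm_cast
  refine Finset.card_le_card fun i hi => ?_
  have hi' : γ ^ 2 * r / n ≤ h i := (Finset.mem_filter.1 hi).2
  have hhi : 0 < h i := lt_of_lt_of_le (by positivity) hi'
  rw [Finset.mem_filter]
  refine ⟨Finset.mem_univ _, fun hiI => ?_, fun ν hν hker => ?_⟩
  · have : h i = 0 := Finset.sum_eq_zero fun k _ => by rw [hWI (e k) (heW k) i hiI]; simp
    linarith
  set x : EuclideanSpace ℝ (Fin n) := ∑ k, e k i • e k with hx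
  have hxW : x ∈ W := W.sum_mem fun k _ => W.smul_mem _ (heW k)
  have hxi : x i = h i := by
    rw [hx, WithLp.ofLp_sum, Finset.sum_apply]
    exact Finset.sum_congr rfl fun k _ => (sq (e k i)).symm
  have hxnorm : ‖x‖ = √(h i) := by
    rw [← Real.sqrt_sq (norm_nonneg x), ← real_inner_self_eq_norm_sq, hx, heo.inner_sum]
    congr 1
    exact Finset.sum_congr rfl fun k _ => by rw [conj_trivial, sq]
  -- Columns in `I` drop out because `x` vanishes there, the others except the `i`-th because `ν` is
  -- normal to them.
  have hinner : inner ℝ (M x) ν = h i * ∑ j, Γ.adjMatrix j i * ν j * N j i := by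
    rw [hM, inner_toEuclideanLin_hadamard, Finset.sum_eq_single i, hxi]
    · intro k _ hk
      by_cases hkI : k ∈ I
      · rw [hWI x hxW k hkI, zero_mul]
      · rw [(Γ.columnEquations_eq_zero_iff _ N ν).1 hker k (by simp [hk, hkI]), mul_zero]
    · simp
  have h1 : |h i * ∑ j, Γ.adjMatrix j i * ν j * N j i| ≤ ρ * √(h i) := by
    rw [← hinner, ← hxnorm]
    refine (abs_real_inner_le_norm _ _).trans ?_
    rw [hν, mul_one]
    exact hWρ x hxW
  have hsq : 0 < √(h i) := Real.sqrt_pos.2 hhi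
  have h2 : |∑ j, Γ.adjMatrix j i * ν j * N j i| * √(h i) ≤ ρ := by
    rw [abs_mul, abs_of_pos hhi] at h1
    refine le_of_mul_le_mul_right ?_ hsq
    calc _ = (√(h i) * √(h i)) * |∑ j, Γ.adjMatrix j i * ν j * N j i| := by ring
      _ = h i * |∑ j, Γ.adjMatrix j i * ν j * N j i| := by rw [Real.mul_self_sqrt hhi.le]
      _ ≤ _ := h1
  have h3 : γ * √(r : ℝ) / √(n : ℝ) ≤ √(h i) := by
    refine Real.le_sqrt_of_sq_le ?_
    rw [div_pow, mul_pow, Real.sq_sqrt hr0.le, Real.sq_sqrt hn.le]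
    exact hi'
  rw [le_div_iff₀ (by positivity)]
  calc |∑ j, Γ.adjMatrix j i * ν j * N j i| * (γ * √(r : ℝ))
      = |∑ j, Γ.adjMatrix j i * ν j * N j i| * (γ * √(r : ℝ) / √(n : ℝ)) * √(n : ℝ) := by
        field_simp
    _ ≤ |∑ j, Γ.adjMatrix j i * ν j * N j i| * √(h i) * √(n : ℝ) := by gcongr
    _ ≤ ρ * √(n : ℝ) := by gcongr

end SmallSingularValues

/-! ### Averaging over the columns and the bound for a general `r`. -/

open Classical in
lemma measure_card_mem_ge_le {n : ℕ} (hn : 0 < n) {Ω : Type*} [MeasurableSpace Ω] {P : Measure Ω}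
    [IsProbabilityMeasure P] (Z : Fin n → Set Ω) {α p : ℝ} (hα : 0 < α)
    (hZ : ∀ i, P.real (Z i) ≤ p) :
    P.real {ω | α * n ≤ (Finset.univ.filter fun i => ω ∈ Z i).card} ≤ p / α := by
  have hn0 : (0 : ℝ) < n := by exact_mod_cast hn
  -- Measurable hulls, because the `Z i` need not be measurable.
  set f : Ω → ℝ := fun ω => ∑ i, (toMeasurable P (Z i)).indicator 1 ω with hf
  have hint : ∀ i, Integrable ((toMeasurable P (Z i)).indicator (1 : Ω → ℝ)) P := fun i =>
    (integrable_const 1).indicator (measurableSet_toMeasurable _ _)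
  have hf0 : ∀ ω, 0 ≤ f ω := fun ω =>
    Finset.sum_nonneg fun i _ => Set.indicator_nonneg (fun _ _ => zero_le_one) _
  have h1 := mul_meas_ge_le_integral_of_nonneg (ae_of_all _ hf0)
    (integrable_finsetSum _ fun i _ => hint i) (α * n)
  have h2 : ∫ ω, f ω ∂P ≤ n * p := by
    rw [hf, integral_finsetSum _ fun i _ => hint i]
    calc ∑ i, ∫ ω, (toMeasurable P (Z i)).indicator 1 ω ∂P ≤ ∑ _i : Fin n, p := by
          refine Finset.sum_le_sum fun i _ => ?_
          rw [integral_indicator_one (measurableSet_toMeasurable _ _), measureReal_def,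
            measure_toMeasurable]
          exact hZ i
      _ = n * p := by simp
  have h3 : P.real {ω | α * n ≤ (Finset.univ.filter fun i => ω ∈ Z i).card}
      ≤ P.real {ω | α * n ≤ f ω} := by
    refine measureReal_mono (fun ω hω => ?_) (measure_ne_top _ _)
    simp only [Set.mem_ofPred_eq] at hω ⊢
    refine hω.trans ?_
    rw [Finset.card_filter, Nat.cast_sum]
    refine Finset.sum_le_sum fun i _ => ?_
    by_cases hi : ω ∈ Z i
    · simp [hi, subset_toMeasurable P (Z i) hi]
    · rw [if_neg hi, Nat.cast_zero]
      exact Set.indicator_nonneg (fun _ _ => zero_le_one) _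
  rw [le_div_iff₀ hα]
  have h4 : α * n * P.real {ω | α * n ≤ (Finset.univ.filter fun i => ω ∈ Z i).card} ≤ n * p :=
    (mul_le_mul_of_nonneg_left h3 (by positivity)).trans (h1.trans h2)
  nlinarith

/-- The lower tail of the singular values close to the smallest one. -/
theorem exists_measure_singVal_le {δ κ : ℝ} (hδ : 0 < δ) (hδ1 : δ ≤ 1) (hκ : 0 < κ) :
    ∃ c ε₁ C : ℝ, 0 < c ∧ 0 < ε₁ ∧ 0 < C ∧ ∃ n₀ : ℕ, ∀ {n : ℕ}, n₀ ≤ n →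
      ∀ {Ω : Type*} [MeasurableSpace Ω]
      {P : Measure Ω} {G : Ω → Matrix (Fin n) (Fin n) ℝ}, IsStdGaussianMatrix G P →
      ∀ Γ : BipGraph n n, Γ.BroadlyConnected δ κ → ∀ {m r : ℕ}, 0 < m → 0 < r → m + 2 * r ≤ n + 2 →
      (r : ℝ) ≤ ε₁ * n → ∀ {t : ℝ}, 0 < t → t ≤ 1 →
      P.real {ω | singVal (Γ.adjMatrix ⊙ G ω) m ≤ c * t * (r / √(n : ℝ))}
        ≤ t ^ r + C * Real.exp (-n) := by
  classical
  obtain ⟨γ, hγ, hsparse⟩ := exists_measure_small_image_nearly_sparse_le hδ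
  obtain ⟨ε₁, σ, C, hε₁, hσ, hC, n₀, hspread⟩ := exists_measure_normal_not_spread_le hδ hδ1 hκ
  set α := δ / 4 with hα
  have hα0 : 0 < α := by positivity
  have hα1 : α ≤ 1 := by linarith
  -- The first bound on `c` makes the small-ball ratio at most `α t`, so that `α ^ r` absorbs the
  -- Markov factor `1 / α`; the second keeps `ρ` within the range of the nearly sparse estimate.
  refine ⟨min (γ * σ * α / 2) (8 * γ), ε₁, 2 + C / α, by positivity, hε₁, by positivity, n₀ + 1,
    fun {n} hn Ω _ P G h Γ hΓ m r hm hr hmr hrε t ht ht1 => ?_⟩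
  have := h.indep_entries.isProbabilityMeasure
  set c := min (γ * σ * α / 2) (8 * γ) with hc
  have hc0 : 0 < c := by positivity
  have hn0 : 0 < n := by omega
  have hnR : (0 : ℝ) < n := by exact_mod_cast hn0
  have hrR : (0 : ℝ) < r := by exact_mod_cast hr
  set ρ := c * t * (r / √(n : ℝ)) with hρ
  set u := ρ * √(n : ℝ) / (γ * √(r : ℝ)) with hu
  have hρ0 : 0 < ρ := by positivity
  have hu0 : 0 < u := by positivity
  -- One `I` serves all `i ∉ I`, and `insert i I` has `r` elements. The dimension count `(m - 1) +
  -- (r - 1) + r ≤ n` is `hmr`.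
  obtain ⟨I, -, hI⟩ : ∃ I ⊆ (Finset.univ : Finset (Fin n)), I.card = r - 1 :=
    Finset.exists_subset_card_eq (by simp; omega)
  set Z : Fin n → Set Ω := fun i => {ω | i ∉ I ∧ ∀ ν : EuclideanSpace ℝ (Fin n), ‖ν‖ = 1 →
      Γ.columnEquations (insert i I) (G ω) ν = 0 →
      |∑ j, Γ.adjMatrix j i * ν j * G ω j i| ≤ u} with hZ
  have hratio : 2 * u / (σ * √(r : ℝ)) ≤ α * t := by
    have h1 : 2 * u / (σ * √(r : ℝ)) = 2 * c * t / (γ * σ) := by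
      rw [hu, hρ]
      have : (r : ℝ) = √(r : ℝ) * √(r : ℝ) := (Real.mul_self_sqrt hrR.le).symm
      field_simp
      nlinarith
    rw [h1, div_le_iff₀ (by positivity)]
    have : c ≤ γ * σ * α / 2 := min_le_left _ _
    nlinarith
  have hZp : ∀ i, P.real (Z i) ≤ C * Real.exp (-n) + (α * t) ^ r := by
    intro i
    by_cases hiI : i ∈ I
    · have : Z i = ∅ := Set.eq_empty_of_forall_notMem fun ω hω => hω.1 hiI
      rw [this, measureReal_empty]
      positivity
    have hcard : (insert i I).card = r := by rw [Finset.card_insert_of_notMem hiI, hI]; omega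
    have h1 := hspread (by omega) h Γ hΓ (insert i I) (by rw [hcard]; exact hrε) i
    have h2 := measure_column_nearly_orthogonal_le h Γ (Finset.mem_insert_self i I) hσ hu0
    rw [hcard] at h2
    refine (measureReal_mono (fun ω hω => ?_) (measure_ne_top _ _)).trans
      ((measureReal_union_le _ _).trans (add_le_add h1 (h2.trans (by gcongr))))
    by_cases hb : ∃ ν : EuclideanSpace ℝ (Fin n), ‖ν‖ = 1 ∧
        Γ.columnEquations (insert i I) (G ω) ν = 0 ∧ rowVar Γ.adjMatrixᵀ ν i ≤ σ ^ 2
    · exact Or.inl hb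
    · push Not at hb
      exact Or.inr ⟨hb, hω.2⟩
  have hsp := hsparse hn0 h Γ.adjMatrix Γ.abs_adjMatrix_le fun i => by
    rw [Γ.sum_sq_adjMatrix_left]; exact hΓ.degRight_ge i
  have hop := measure_compl_normBounded_le h Γ.abs_adjMatrix_le
  have hmk := measure_card_mem_ge_le hn0 Z hα0 hZp
  have hρ8 : ρ ≤ 8 * γ * √(n : ℝ) := by
    rw [hρ, mul_div_assoc', div_le_iff₀ (by positivity), mul_assoc (8 * γ),
      Real.mul_self_sqrt hnR.le]
    have h1 : c * t ≤ 8 * γ := (mul_le_of_le_one_right hc0.le ht1).trans (min_le_right _ _)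
    have h2 : (r : ℝ) ≤ n := by exact_mod_cast (by omega : r ≤ n)
    gcongr
  refine (measureReal_mono (fun ω hω => ?_) (measure_ne_top _ _)).trans
    ((measureReal_union_le _ _).trans (add_le_add hop
      ((measureReal_union_le _ _).trans (add_le_add hsp hmk)))) |>.trans ?_
  · by_cases hb : ω ∈ normBounded Γ.adjMatrix G
    swap
    · exact Or.inl hb
    refine Or.inr ?_
    by_cases hcon : ∃ x : EuclideanSpace ℝ (Fin n), ‖x‖ = 1 ∧
        (∃ T : Finset (Fin n), (T.card : ℝ) ≤ δ / 4 * n ∧ ∑ j ∈ Tᶜ, x j ^ 2 ≤ γ ^ 2) ∧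
        ‖Matrix.toEuclideanLin (Γ.adjMatrix ⊙ G ω) x‖ ≤ 8 * γ * √(n : ℝ)
    · exact Or.inl ⟨hb, hcon⟩
    refine Or.inr ?_
    have key := card_nearly_orthogonal_columns_gt Γ (G ω) (s := m - 1) (r := r) (ρ := ρ) (γ := γ)
      (α := α) I hr (by omega) hγ hω fun x hx hxρ T hT => by
        by_contra! hle
        exact hcon ⟨x, hx, ⟨T, hT, by convert hle⟩, hxρ.trans hρ8⟩
    refine le_trans key.le (le_of_eq ?_)
    congr
  · have h1 : (α * t) ^ r / α ≤ t ^ r := by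
      rw [div_le_iff₀ hα0, mul_pow, mul_comm]
      gcongr
      exact pow_le_of_le_one hα0.le hα1 hr.ne'
    have h2 : (C * Real.exp (-n) + (α * t) ^ r) / α
        = C / α * Real.exp (-n) + (α * t) ^ r / α := by ring
    rw [h2]
    linarith

/-! ### Choice of `r` and of the constants. -/

lemma BipGraph.BroadlyConnected.le_one {n : ℕ} {Γ : BipGraph n n} {δ κ : ℝ}
    (hΓ : Γ.BroadlyConnected δ κ) (hn : 0 < n) : δ ≤ 1 := by
  classical
  have h1 := hΓ.degRight_ge ⟨0, hn⟩
  have h2 : (Γ.degRight ⟨0, hn⟩ : ℝ) ≤ n := by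
    exact_mod_cast (Finset.card_le_univ _).trans (by simp)
  have h3 : (0 : ℝ) < n := by exact_mod_cast hn
  nlinarith

lemma const_mul_exp_neg_le {C c' x : ℝ} (hx : 0 ≤ x) (hC : 4 * C ≤ x) (hc' : c' ≤ 1 / 2) :
    C * Real.exp (-x) ≤ Real.exp (-c' * x) / 2 := by
  have h1 : 2 * C ≤ Real.exp (x / 2) := by
    have := Real.add_one_le_exp (x / 2)
    linarith
  have h2 : Real.exp (x / 2) * Real.exp (-x) ≤ Real.exp (-c' * x) := by
    rw [← Real.exp_add, Real.exp_le_exp]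
    nlinarith
  have h3 := mul_le_mul_of_nonneg_right h1 (Real.exp_pos (-x)).le
  linarith

theorem mainTheorem5 (δ κ : ℝ) (hδ : 0 < δ) (hκ : 0 < κ) (hκδ : κ < δ / 2) :
    ∃ c c' : ℝ, 0 < c ∧ 0 < c' ∧ ∃ n₀ : ℕ, ∀ n : ℕ, n₀ ≤ n →
      ∀ Γ : BipGraph n n, Γ.BroadlyConnected δ κ →
      ∀ {Ω : Type*} [MeasurableSpace Ω] (P : Measure Ω) [IsProbabilityMeasure P]
        (G : Ω → Matrix (Fin n) (Fin n) ℝ), IsStdGaussianMatrix G P →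
        (∀ t : ℝ, 0 < t →
          P.real {ω | singVal (Γ.adjMatrix ⊙ G ω) n ≤ c * t * (n : ℝ) ^ (-(1 / 2) : ℝ)}
            ≤ t + Real.exp (-c' * (n : ℝ))) ∧
        (∀ m : ℕ, (n : ℝ) / 2 < (m : ℝ) → (m : ℝ) < (n : ℝ) - 4 → ∀ t : ℝ, 0 < t →
          P.real {ω | singVal (Γ.adjMatrix ⊙ G ω) m
              ≤ c * t * (((n : ℝ) - (m : ℝ)) / Real.sqrt (n : ℝ))}
            ≤ t ^ (((n : ℝ) - (m : ℝ)) / 4) + Real.exp (-c' * (n : ℝ))) := by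
  rcases lt_or_ge 1 δ with hδ1 | hδ1
  · refine ⟨1, 1, one_pos, one_pos, 1, fun n hn Γ hΓ => ?_⟩
    exact absurd (hΓ.le_one hn) (not_le.2 hδ1)
  obtain ⟨c, ε₁, C, hc, hε₁, hC, n₀, key⟩ := exists_measure_singVal_le hδ hδ1 hκ
  -- The factor `1/4` pays for `l ≤ 4 ⌊l / 2⌋`, the other for `l ≤ n ≤ (2 / ε₁) r` when `r = ⌊ε₁
  -- n⌋`.
  set c₁ := c * min (1 / 4) (Real.exp (-1) * (ε₁ / 2)) with hc₁
  set c' := min (1 / 2) (ε₁ / 4) with hc'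
  have hc'2 : c' ≤ 1 / 2 := min_le_left _ _
  obtain ⟨n₁, hn₁⟩ := exists_nat_ge (max (4 / ε₁) (4 * C))
  refine ⟨c₁, c', by positivity, by positivity, max (n₀ + 1) n₁,
    fun n hn Γ hΓ Ω _ P _ G h => ?_⟩
  have hn₀ : n₀ ≤ n := by have := le_of_max_le_left hn; omega
  have hn0 : 0 < n := by have := le_of_max_le_left hn; omega
  have hnR : (0 : ℝ) < n := by exact_mod_cast hn0
  have hnn₁ : (n₁ : ℝ) ≤ n := by exact_mod_cast le_of_max_le_right hn
  have hεn : 4 ≤ ε₁ * n := by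
    have := ((le_max_left _ _).trans hn₁).trans hnn₁
    rwa [div_le_iff₀ hε₁, mul_comm] at this
  have hCn : 4 * C ≤ n := ((le_max_right _ _).trans hn₁).trans hnn₁
  have hexp : C * Real.exp (-n) ≤ Real.exp (-c' * n) / 2 := const_mul_exp_neg_le hnR.le hCn hc'2
  have hpos := Real.exp_pos (-c' * n)
  have hc₁4 : c₁ ≤ c * (1 / 4) := by rw [hc₁]; gcongr; exact min_le_left _ _
  have hc₁e : c₁ ≤ c * (Real.exp (-1) * (ε₁ / 2)) := by rw [hc₁]; gcongr; exact min_le_right _ _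
  refine ⟨fun t ht => ?_, fun m hm1 hm2 t ht => ?_⟩
  · rcases le_or_gt t 1 with ht1 | ht1
    swap
    · exact measureReal_le_one.trans (by linarith)
    have h1 := key hn₀ h Γ hΓ hn0 one_pos (by omega) (by push_cast; linarith) ht ht1
    rw [pow_one] at h1
    refine (measureReal_mono (fun ω hω => ?_) (measure_ne_top _ _)).trans
      (h1.trans (by linarith))
    refine le_trans (Set.mem_ofPred_eq ▸ hω) ?_
    rw [Real.rpow_neg hnR.le, ← Real.sqrt_eq_rpow, Nat.cast_one, one_div]
    gcongr
    linarith
  · rcases le_or_gt t 1 with ht1 | ht1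
    swap
    · have : 1 ≤ t ^ (((n : ℝ) - m) / 4) := Real.one_le_rpow ht1.le (by linarith)
      exact measureReal_le_one.trans (by linarith)
    have hmn : m + 4 < n := by
      have : (m : ℝ) + 4 < n := by linarith
      exact_mod_cast this
    have hm0 : 0 < m := by
      have : (0 : ℝ) < m := by linarith
      exact_mod_cast this
    obtain ⟨l, rfl⟩ : ∃ l, n = m + l := ⟨n - m, by omega⟩
    have hl : ((m + l : ℕ) : ℝ) - m = l := by push_cast; ring
    rw [hl]
    have htl : 0 ≤ t ^ ((l : ℝ) / 4) := Real.rpow_nonneg ht.le _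
    rcases le_or_gt ((l / 2 : ℕ) : ℝ) (ε₁ * (m + l : ℕ)) with hle | hgt
    · have h1 := key hn₀ h Γ hΓ (r := l / 2) hm0 (by omega) (by omega) hle ht ht1
      have h4 : (l : ℝ) ≤ 4 * ((l / 2 : ℕ) : ℝ) := by exact_mod_cast (by omega : l ≤ 4 * (l / 2))
      refine (measureReal_mono (fun ω hω => ?_) (measure_ne_top _ _)).trans
        (h1.trans (add_le_add ?_ (by linarith)))
      · refine le_trans (Set.mem_ofPred_eq ▸ hω) ?_
        calc c₁ * t * ((l : ℝ) / √((m + l : ℕ) : ℝ))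
            ≤ c * (1 / 4) * t * (4 * ((l / 2 : ℕ) : ℝ) / √((m + l : ℕ) : ℝ)) := by gcongr
          _ = _ := by ring
      · rw [← Real.rpow_natCast]
        exact Real.rpow_le_rpow_of_exponent_ge ht ht1 (by linarith)
    -- Here `⌊l / 2⌋` is too large for `key`. With `r` capped and `t` replaced by `exp (-1)`, the
    -- bound `exp (-r)` is absorbed into the exponential term.
    · set r := ⌊ε₁ * (m + l : ℕ)⌋₊ with hr
      have hrle : (r : ℝ) ≤ ε₁ * (m + l : ℕ) := Nat.floor_le (by positivity)
      have hrge : ε₁ / 2 * (m + l : ℕ) ≤ r := by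
        have := Nat.lt_floor_add_one (ε₁ * (m + l : ℕ))
        rw [← hr] at this
        linarith
      have hrl : r ≤ l / 2 := by exact_mod_cast (hrle.trans hgt.le)
      have hr0 : 0 < r := by
        have : (0 : ℝ) < r := by linarith
        exact_mod_cast this
      have h1 := key hn₀ h Γ hΓ (r := r) hm0 hr0 (by omega) hrle (Real.exp_pos (-1))
        (by rw [Real.exp_le_one_iff]; norm_num)
      refine (measureReal_mono (fun ω hω => ?_) (measure_ne_top _ _)).trans (h1.trans ?_)
      · refine le_trans (Set.mem_ofPred_eq ▸ hω) ?_
        have hlR : (l : ℝ) ≤ (m + l : ℕ) := by push_cast; linarith [Nat.cast_nonneg (α := ℝ) m]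
        calc c₁ * t * ((l : ℝ) / √((m + l : ℕ) : ℝ))
            ≤ c * (Real.exp (-1) * (ε₁ / 2)) * 1 * (((m + l : ℕ) : ℝ) / √((m + l : ℕ) : ℝ)) := by
              gcongr
          _ = c * Real.exp (-1) * (ε₁ / 2 * (m + l : ℕ) / √((m + l : ℕ) : ℝ)) := by ring
          _ ≤ _ := by gcongr
      · have h2 : Real.exp (-1) ^ r ≤ Real.exp (-c' * (m + l : ℕ)) / 2 := by
          rw [← Real.exp_nat_mul, le_div_iff₀ two_pos]
          have h3 : (2 : ℝ) ≤ Real.exp 1 := by linarith [Real.exp_one_gt_d9]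
          calc Real.exp (r * -1) * 2 ≤ Real.exp (r * -1) * Real.exp 1 := by gcongr
            _ = Real.exp (r * -1 + 1) := (Real.exp_add _ _).symm
            _ ≤ _ := by
              rw [Real.exp_le_exp]
              have h5 : c' * (m + l : ℕ) ≤ ε₁ / 4 * (m + l : ℕ) := by
                gcongr; exact min_le_right _ _
              linarith
        linarith
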